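/- Let $\mathbb T=\mathbb R/\mathbb Z$, let $\alpha\in\mathbb R\setminus\mathbb Q$, $\gamma\in\mathbb R$, and let $r,s\ge 3$ be odd, relatively prime integers; choose $a,b\in\mathbb Z$ with $ar+bs=1$. Let $Tx=x+\alpha$ and $\psi(x)=x+\gamma$ on $\mathbb T$, put $\psi^{(n)}(x)=\sum_{i=0}^{n-1}\psi(T^ix)$ and $\Psi(x,y)=(\psi^{(r)}(x),\psi^{(s)}(y))$, and let $\Phi=(T^r\times T^s)_\Psi$ be the homeomorphism of $\mathbb T^4$ given by $$\Phi(x,y,u,v)=\bigl(x+r\alpha,\;y+s\alpha,\;u+\psi^{(r)}(x),\;v+\psi^{(s)}(y)\bigr).$$ For $c_1\in[0,\frac1r)$ let $$I_{c_1}=\{(x,y+c_1,u,v)\in\mathbb T^4: sx=ry\}.$$ If $(s-r)\gamma-rc_1\in\mathbb Q\alpha+\mathbb Q$, let $l_0$ be the smallest positive integer with $l_0rs((s-r)\gamma-rc_1)\in\mathbb Z\alpha+\mathbb Z$, let $k_0\in\mathbb Z$ be such that $l_0rs((s-r)\gamma-rc_1)-k_0\alpha\in\mathbb Z$, and for $c_2\in[0,\frac1{r^2})$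 let $$J_{c_1,c_2}=\Bigl\{(x,y+c_1,u,v+c_2)\in\mathbb T^4:\ sx=ry,\ \ l_0s^2u=l_0r^2v+\Bigl(l_0rs\tfrac{r-s}2+k_0\Bigr)(ax+by)\Bigr\}.$$ Let $\mathcal P$ be the family consisting of the sets $I_{c_1}$ with $c_1\in[0,\frac1r)$, $(s-r)\gamma-rc_1\notin\mathbb Q\alpha+\mathbb Q$, and of the sets $J_{c_1,c_2}$ with $c_1\in[0,\frac1r)$, $(s-r)\gamma-rc_1\in\mathbb Q\alpha+\mathbb Q$, $c_2\in[0,\frac1{r^2})$. Then: 1. $\mathcal P$ is a partition of $\mathbb T^4$, and it is exactly the family of minimal components of $\Phi$ (the nonempty closed invariant sets with no proper subset having the same properties). 2. $\mathcal P$ is also the decomposition of $\mathbb T^4$ into ergodic components of $\Phi$, in both of the following senses. The members of $\mathcal P$ are exactly the sets of generic points of the ergodic $\Phi$-invariant Borel probability measures. For every $\Phi$-invariant Borel probability measure $\mu$ on $\mathbb T^4$, the partition $\mathcal P$ is measurable with invariant atoms and it is finer, up to a $\mu$-null set, than every measurable partition of $\mathbb T^4$ into $\Phi$-invariant sets. (A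 partition is measurable if its atoms are separated by countably many Borel unions of atoms.) 3. For every $C\in\mathcal P$ the restriction $\Phi|_C$ is uniquely ergodic: there is exactly one $\Phi$-invariant Borel probability measure $\nu_C$ on $\mathbb T^4$ with $\nu_C(C)=1$. 4. Every point of $\mathbb T^4$ is generic: for all $C\in\mathcal P$, $p\in C$ and continuous $g:\mathbb T^4\to\mathbb R$, $$\frac1N\sum_{n=0}^{N-1}g(\Phi^np)\longrightarrow\int g\,d\nu_C\qquad(N\to\infty).$$ -/

import Mathlib

open Set Filter MeasureTheory Topology

namespace AffineCocycle

/-! ### General notions for a bijective map -/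

/-- The skew product (group extension) `T_φ (x, g) = (T x, g + φ x)`. -/
def skewProduct {X G : Type*} [Add G] (T : X → X) (φ : X → G) : X × G → X × G :=
  fun p => (T p.1, p.2 + φ p.1)

/-- `M` is a minimal component of the homeomorphism `Φ`: a nonempty closed set, invariant
under `Φ`, none of whose proper subsets has the same properties. -/
def IsMinimalComponent {X : Type*} [TopologicalSpace X] (Φ : X → X) (M : Set X) : Prop :=
  M.Nonempty ∧ IsClosed M ∧ Φ ⁻¹' M = M ∧
    ∀ N : Set X, N ⊆ M → N.Nonempty → IsClosed N → Φ ⁻¹' N = N → N = M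

/-- `x` is generic for the measure `ν`: all ergodic averages of continuous functions along the
orbit of `x` converge to the integral with respect to `ν`. -/
def IsGeneric {X : Type*} [TopologicalSpace X] [MeasurableSpace X]
    (Φ : X → X) (ν : Measure X) (x : X) : Prop :=
  ∀ g : C(X, ℝ), Tendsto (fun N : ℕ => birkhoffAverage ℝ Φ g N x) atTop (𝓝 (∫ z, g z ∂ν))

/-- The ergodic components of `Φ` in the pointwise sense (the ergodic sets of Kryloff and
Bogoliouboff): for each ergodic invariant probability measure, the set of its generic points. -/
def ergodicComponents {X : Type*} [TopologicalSpace X] [MeasurableSpace X]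
    (Φ : X → X) : Set (Set X) :=
  {C | ∃ ν : Measure X, IsProbabilityMeasure ν ∧ Ergodic Φ ν ∧ C = {x | IsGeneric Φ ν x}}

/-- A measurable partition (in the sense of Rokhlin): there are countably many measurable unions
of atoms which separate the atoms. -/
def IsMeasurablePartition {X : Type*} [MeasurableSpace X] (P : Set (Set X)) : Prop :=
  Setoid.IsPartition P ∧
    ∃ B : ℕ → Set X, (∀ n, MeasurableSet (B n)) ∧
      (∀ n, ∀ C ∈ P, C ⊆ B n ∨ Disjoint C (B n)) ∧
      ∀ C ∈ P, ∀ D ∈ P, C ≠ D →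
        ∃ n, (C ⊆ B n ∧ Disjoint D (B n)) ∨ (D ⊆ B n ∧ Disjoint C (B n))

/-- `P` is the partition into ergodic components of the measure-preserving system `(X, μ, Φ)`:
the finest, up to a `μ`-null set, measurable partition with invariant atoms. -/
def IsErgodicPartition {X : Type*} [MeasurableSpace X]
    (Φ : X → X) (μ : Measure X) (P : Set (Set X)) : Prop :=
  (IsMeasurablePartition P ∧ ∀ C ∈ P, Φ ⁻¹' C = C) ∧
    ∀ Q : Set (Set X), IsMeasurablePartition Q → (∀ D ∈ Q, Φ ⁻¹' D = D) →
      ∃ E : Set X, μ Eᶜ = 0 ∧ ∀ C ∈ P, ∃ D ∈ Q, C ∩ E ⊆ D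

/-- `Φ` restricted to the invariant set `C` is uniquely ergodic: exactly one `Φ`-invariant
probability measure is carried by `C`. -/
def IsUniquelyErgodicOn {X : Type*} [MeasurableSpace X] (Φ : X → X) (C : Set X) : Prop :=
  ∃! ν : Measure X, IsProbabilityMeasure ν ∧ MeasurePreserving Φ ν ν ∧ ν Cᶜ = 0

/-! ### The affine system on the four-dimensional torus -/

/-- The torus `𝕋⁴`, with coordinates `((x, y), (u, v))`. -/
abbrev Torus4 : Type := (UnitAddCircle × UnitAddCircle) × (UnitAddCircle × UnitAddCircle)

/-- The rotation `T x = x + α`. -/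
def rotation (α : ℝ) : UnitAddCircle → UnitAddCircle := fun x => x + (α : UnitAddCircle)

/-- The affine cocycle `ψ x = x + γ`. -/
def psi (γ : ℝ) : UnitAddCircle → UnitAddCircle := fun x => x + (γ : UnitAddCircle)

/-- `Ψ (x, y) = (ψ⁽ʳ⁾ x, ψ⁽ˢ⁾ y)`, where `ψ⁽ⁿ⁾ x = ∑ i < n, ψ (Tⁱ x)`. -/
def bigPsi (α γ : ℝ) (r s : ℕ) (p : UnitAddCircle × UnitAddCircle) :
    UnitAddCircle × UnitAddCircle :=
  (birkhoffSum (rotation α) (psi γ) r p.1, birkhoffSum (rotation α) (psi γ) s p.2)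

/-- The map `(Tʳ × Tˢ)_Ψ` on `𝕋⁴`. -/
def affineMap (α γ : ℝ) (r s : ℕ) : Torus4 → Torus4 :=
  skewProduct (Prod.map (rotation α)^[r] (rotation α)^[s]) (bigPsi α γ r s)

/-- `A_{c₁} = {(x, y + c₁) : s x = r y}`. -/
def setA (r s : ℕ) (c₁ : ℝ) : Set (UnitAddCircle × UnitAddCircle) :=
  {p | ∃ x y : UnitAddCircle, s • x = r • y ∧ p = (x, y + (c₁ : UnitAddCircle))}

/-- `I_{c₁} = A_{c₁} × 𝕋²`. -/
def setI (r s : ℕ) (c₁ : ℝ) : Set Torus4 := setA r s c₁ ×ˢ univ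

/-- The set of all `(x, y + c₁, u, v + c₂)` with `s x = r y` and
`l s² u = l r² v + (l r s (r - s) / 2 + k) (a x + b y)`.
It is used for odd `r`, `s` only, so that the integer division by `2` is exact. -/
def setJ (r s : ℕ) (a b : ℤ) (l : ℕ) (k : ℤ) (c₁ c₂ : ℝ) : Set Torus4 :=
  {p | ∃ x y u v : UnitAddCircle, s • x = r • y ∧
    (l * s ^ 2) • u = (l * r ^ 2) • v +
      ((l : ℤ) * r * s * (((r : ℤ) - s) / 2) + k) • (a • x + b • y) ∧
    p = ((x, y + (c₁ : UnitAddCircle)), (u, v + (c₂ : UnitAddCircle)))}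

/-- `t ∈ ℚ α + ℚ`. -/
def InRatSpan (α t : ℝ) : Prop := ∃ p q : ℚ, t = p * α + q

/-- `t ∈ ℤ α + ℤ`. -/
def InIntSpan (α t : ℝ) : Prop := ∃ p q : ℤ, t = p * α + q

/-- The number `(s - r) γ - r c₁`. -/
def freq (γ : ℝ) (r s : ℕ) (c₁ : ℝ) : ℝ := ((s : ℝ) - r) * γ - r * c₁

/-- `l` and `k` are the integers `l₀` and `k₀` attached to `c₁`: `l` is the least positive integer
with `l r s ((s - r) γ - r c₁) ∈ ℤ α + ℤ`, and `l r s ((s - r) γ - r c₁) - k α ∈ ℤ`. -/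
def IsResonance (α γ : ℝ) (r s : ℕ) (c₁ : ℝ) (l : ℕ) (k : ℤ) : Prop :=
  IsLeast {n : ℕ | 0 < n ∧ InIntSpan α (n * r * s * freq γ r s c₁)} l ∧
    ∃ m : ℤ, l * r * s * freq γ r s c₁ - k * α = m

/-- The sets `I_{c₁}` with `(s - r) γ - r c₁ ∉ ℚ α + ℚ` together with the sets `J_{c₁, c₂}` with
`(s - r) γ - r c₁ ∈ ℚ α + ℚ`, where `c₁ ∈ [0, 1 / r)` and `c₂ ∈ [0, 1 / r²)`. -/
def components (α γ : ℝ) (r s : ℕ) (a b : ℤ) : Set (Set Torus4) :=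
  {C | ∃ c₁ ∈ Ico (0 : ℝ) (1 / r), ¬ InRatSpan α (freq γ r s c₁) ∧ C = setI r s c₁} ∪
  {C | ∃ c₁ ∈ Ico (0 : ℝ) (1 / r), ∃ c₂ ∈ Ico (0 : ℝ) (1 / (r : ℝ) ^ 2),
    InRatSpan α (freq γ r s c₁) ∧
    ∃ (l : ℕ) (k : ℤ), IsResonance α γ r s c₁ l k ∧ C = setJ r s a b l k c₁ c₂}

end AffineCocycle

/-!
On the level sets of `s x - r y` the affine map is a skew product over a rotation, and its
behaviour is read off from the characters `θ = m₁ x + m₂ y + j u + k v` of `𝕋⁴`. Along the orbit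
of a point `p` such a character has a quadratic phase,
`θ (Φⁿ p) = θ p + n A + (n choose 2) B` with `B = (j r² + k s²) α` (`torusChar_iterate`).

Each member of the family is a coset of a closed subgroup `H` of `𝕋⁴`, invariant under `Φ`. If `θ`
is trivial on `H`, it is constant on the coset. Otherwise `A` and `B` do not both vanish: since `r`
and `s` are coprime, `B = 0` forces `(j, k) = q (s², -r²)`, and then `A = M α + q r s freq` modulo
`1` with an integer `M` (`linearPhase_eq`). If `freq` is not in `ℚ α + ℚ`, the vanishing of `A`
gives `q = 0` and makes `θ` a multiple of `s x - r y`; at a resonance it gives `l ∣ q` and makes `θ`,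
on the subgroup `s x = r y`, a multiple of the character that defines `setJ`
(`torusChar_eq_zero_of_not_inRatSpan`, `torusChar_eq_zero_of_isResonance`). So the averages of a
character nontrivial on `H` tend to zero: by a geometric sum if `B = 0`, and by van der Corput's
inequality if `B ≠ 0`, as `α` is irrational (`tendsto_average_linear_phase`,
`tendsto_average_quadratic_phase`). Zero is also the integral of `θ` with respect to the Haar measure
of the coset. By the Stone–Weierstrass theorem every point is generic for the Haar measure of
its coset (`exists_isGenericPartition_of_cosets`).

The rest holds for every partition of a compact metric space into closed invariant sets `C` with
measures `ν C`, positive on the relatively open subsets of `C`, for which all points of `C` are generic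
(`IsGenericPartition`). Unique ergodicity follows by integrating ergodic averages. It implies
ergodicity, since the conditional measure on an invariant set is again invariant. A closed invariant
set meeting `C` contains `C`, because a continuous function vanishing on the set has zero averages
along an orbit in `C`, hence zero integral. The limits of ergodic averages of countably many dense
continuous functions are Borel functions that separate the classes, so that the partition is
measurable. Finally the indicator of an invariant Borel set is an `L¹`-limit of continuous
functions, hence also of the limits of their ergodic averages; these are constant on the classes, so
the set agrees almost everywhere with a union of classes (`exists_ae_saturated`). No disintegration
of measures and no pointwise ergodic theorem is needed.
-/

namespace AffineCocycle

/-! ### Generic points and invariant measures -/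

section Generic

variable {X : Type*} [MetricSpace X] [CompactSpace X] [MeasurableSpace X] [BorelSpace X]

/-- Two finite measures on a metric space with the same integrals of continuous functions
coincide. -/
theorem measure_ext_of_integral_continuousMap {X : Type*} [MetricSpace X] [MeasurableSpace X]
    [BorelSpace X] {μ ν : Measure X} [IsFiniteMeasure μ]
    [IsFiniteMeasure ν] (h : ∀ g : C(X, ℝ), ∫ x, g x ∂μ = ∫ x, g x ∂ν) : μ = ν :=
  ext_of_forall_integral_eq_of_IsFiniteMeasure fun f => h f.toContinuousMap

theorem IsGeneric.measure_unique {X : Type*} [MetricSpace X] [MeasurableSpace X] [BorelSpace X]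
    {Φ : X → X} {μ ν : Measure X} [IsFiniteMeasure μ] [IsFiniteMeasure ν] {x : X}
    (hμ : IsGeneric Φ μ x) (hν : IsGeneric Φ ν x) : μ = ν :=
  measure_ext_of_integral_continuousMap fun g => tendsto_nhds_unique (hμ g) (hν g)

theorem integrable_continuousMap (μ : Measure X) [IsFiniteMeasure μ] (g : C(X, ℝ)) :
    Integrable g μ :=
  g.continuous.integrable_of_hasCompactSupport (HasCompactSupport.of_compactSpace _)

/-- A finite measure with a generic point is invariant. -/
theorem IsGeneric.measurePreserving {Φ : X → X} (hΦ : Continuous Φ) {ν : Measure X}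
    [IsFiniteMeasure ν] {x : X} (hx : IsGeneric Φ ν x) : MeasurePreserving Φ ν ν := by
  refine ⟨hΦ.measurable, measure_ext_of_integral_continuousMap fun g => ?_⟩
  rw [integral_map hΦ.aemeasurable g.continuous.aestronglyMeasurable]
  have h₁ := hx (g.comp ⟨Φ, hΦ⟩)
  have h₂ : Tendsto (fun n => birkhoffAverage ℝ Φ g n (Φ x) - birkhoffAverage ℝ Φ g n x)
      atTop (𝓝 0) := by
    apply tendsto_birkhoffAverage_apply_sub_birkhoffAverage
    exact (isCompact_range g.continuous).isBounded.subset (range_subset_iff.2 fun n => ⟨_, rfl⟩)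
  have h₃ : (fun n => birkhoffAverage ℝ Φ g n (Φ x)) =
      fun n => birkhoffAverage ℝ Φ (g.comp ⟨Φ, hΦ⟩) n x := by
    funext n
    simp only [birkhoffAverage, birkhoffSum, ContinuousMap.comp_apply, ContinuousMap.coe_mk,
      ← Function.iterate_succ_apply, Function.iterate_succ_apply']
  have h₄ := h₂.add (hx g)
  simp only [sub_add_cancel, zero_add] at h₄
  rw [h₃] at h₄
  exact tendsto_nhds_unique h₁ h₄

theorem norm_birkhoffAverage_le {X : Type*} [TopologicalSpace X] [CompactSpace X]
    (Φ : X → X) (g : C(X, ℝ)) (n : ℕ) (x : X) :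
    ‖birkhoffAverage ℝ Φ g n x‖ ≤ ‖g‖ := by
  rcases Nat.eq_zero_or_pos n with rfl | hn
  · simp
  · rw [birkhoffAverage, norm_smul, norm_inv, RCLike.norm_natCast,
      inv_mul_le_iff₀ (by exact_mod_cast hn)]
    refine (norm_sum_le_of_le _ fun i _ => g.norm_coe_le_norm _).trans (by simp)

theorem continuous_birkhoffAverage {X : Type*} [TopologicalSpace X] {Φ : X → X}
    (hΦ : Continuous Φ) (g : C(X, ℝ)) (n : ℕ) :
    Continuous (birkhoffAverage ℝ Φ g n) := by
  change Continuous fun x => (n : ℝ)⁻¹ * ∑ i ∈ Finset.range n, g (Φ^[i] x)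
  exact continuous_const.mul
    (continuous_finsetSum _ fun i _ => g.continuous.comp (hΦ.iterate i))

theorem integral_birkhoffAverage {X : Type*} [MeasurableSpace X] {Φ : X → X} {μ : Measure X}
    [IsFiniteMeasure μ] (hμ : MeasurePreserving Φ μ μ) (g : X → ℝ)
    (hg : Integrable g μ) {n : ℕ} (hn : n ≠ 0) :
    ∫ x, birkhoffAverage ℝ Φ g n x ∂μ = ∫ x, g x ∂μ := by
  have h : ∀ i ∈ Finset.range n, ∫ x, g (Φ^[i] x) ∂μ = ∫ x, g x ∂μ := fun i _ => by
    have := integral_map (μ := μ) (hμ.iterate i).measurable.aemeasurable (f := g)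
      (by rw [(hμ.iterate i).map_eq]; exact hg.aestronglyMeasurable)
    rw [(hμ.iterate i).map_eq] at this
    exact this.symm
  simp only [birkhoffAverage, birkhoffSum]
  rw [integral_smul, integral_finsetSum _ fun i _ => show Integrable (fun x => g (Φ^[i] x)) μ from
    (hμ.iterate i).integrable_comp_of_integrable hg, Finset.sum_congr rfl h]
  simp [hn]

/-- If almost every point is generic for `ν`, an invariant probability measure equals `ν`. -/
theorem eq_of_ae_isGeneric {Φ : X → X} (hΦ : Continuous Φ) {μ ν : Measure X}
    [IsProbabilityMeasure μ] [IsProbabilityMeasure ν] (hμ : MeasurePreserving Φ μ μ)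
    (h : ∀ᵐ x ∂μ, IsGeneric Φ ν x) : μ = ν := by
  refine measure_ext_of_integral_continuousMap fun g => ?_
  have h₁ : Tendsto (fun n => ∫ x, birkhoffAverage ℝ Φ g n x ∂μ) atTop
      (𝓝 (∫ _, (∫ z, g z ∂ν) ∂μ)) := by
    refine tendsto_integral_of_dominated_convergence (fun _ => ‖g‖) (fun n => ?_)
      (integrable_const _) (fun n => ?_) ?_
    · exact (continuous_birkhoffAverage hΦ g n).aestronglyMeasurable
    · exact Eventually.of_forall fun x => norm_birkhoffAverage_le Φ g n x
    · filter_upwards [h] with x hx using hx g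
  have h₂ : Tendsto (fun n => ∫ x, birkhoffAverage ℝ Φ g n x ∂μ) atTop (𝓝 (∫ x, g x ∂μ)) := by
    refine tendsto_const_nhds.congr' ?_
    filter_upwards [eventually_ne_atTop 0] with n hn
    exact (integral_birkhoffAverage hμ g (integrable_continuousMap μ g) hn).symm
  simpa using tendsto_nhds_unique h₂ h₁

end Generic

/-! ### Partitions into uniquely ergodic closed sets -/

/-- A partition of `X` into closed invariant sets `C`, each of which carries a probability measure
`ν C`, positive on the nonempty relatively open subsets of `C`, for which all points of `C` are
generic. -/
structure IsGenericPartition {X : Type*} [TopologicalSpace X] [MeasurableSpace X]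
    (Φ : X → X) (P : Set (Set X)) (ν : Set X → Measure X) : Prop where
  isPartition : Setoid.IsPartition P
  isClosed : ∀ C ∈ P, IsClosed C
  preimage_eq : ∀ C ∈ P, Φ ⁻¹' C = C
  prob : ∀ C ∈ P, IsProbabilityMeasure (ν C)
  compl_eq_zero : ∀ C ∈ P, ν C Cᶜ = 0
  open_ne_zero : ∀ C ∈ P, ∀ U : Set X, IsOpen U → (C ∩ U).Nonempty → ν C U ≠ 0
  generic : ∀ C ∈ P, ∀ x ∈ C, IsGeneric Φ (ν C) x

/-- A union of invariant classes of a partition is invariant. -/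
theorem preimage_eq_of_saturated {X : Type*} {Φ : X → X} {P : Set (Set X)}
    (hP : Setoid.IsPartition P) (hinv : ∀ C ∈ P, Φ ⁻¹' C = C) {B : Set X}
    (hB : ∀ C ∈ P, C ⊆ B ∨ Disjoint C B) : Φ ⁻¹' B = B := by
  ext x
  obtain ⟨C, ⟨hC, hx⟩, -⟩ := hP.2 x
  have hΦx : Φ x ∈ C := by rw [← mem_preimage, hinv C hC]; exact hx
  rcases hB C hC with h | h
  · exact ⟨fun _ => h hx, fun _ => h hΦx⟩
  · exact ⟨fun h' => (disjoint_left.1 h hΦx h').elim, fun h' => (disjoint_left.1 h hx h').elim⟩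

namespace IsGenericPartition

section Basic

variable {X : Type*} [TopologicalSpace X] [MeasurableSpace X] {Φ : X → X} {P : Set (Set X)}
  {ν : Set X → Measure X}

theorem exists_mem (h : IsGenericPartition Φ P ν) (x : X) : ∃ C ∈ P, x ∈ C := by
  obtain ⟨C, hC, -⟩ := h.isPartition.2 x
  exact ⟨C, hC⟩

theorem nonempty (h : IsGenericPartition Φ P ν) {C : Set X} (hC : C ∈ P) : C.Nonempty :=
  nonempty_iff_ne_empty.2 fun h' => h.isPartition.1 (h' ▸ hC)

theorem eq_of_mem (h : IsGenericPartition Φ P ν) {C D : Set X} (hC : C ∈ P) (hD : D ∈ P) {x : X}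
    (hxC : x ∈ C) (hxD : x ∈ D) : C = D :=
  (h.isPartition.2 x).unique ⟨hC, hxC⟩ ⟨hD, hxD⟩

theorem eq_of_measure_eq (h : IsGenericPartition Φ P ν) {C D : Set X} (hC : C ∈ P) (hD : D ∈ P)
    (hν : ν C = ν D) : C = D := by
  by_contra hne
  have := h.prob C hC
  have hdisj : Dᶜ ∪ Cᶜ = univ := by
    refine eq_univ_of_forall fun x => ?_
    by_contra hx
    simp only [mem_union, mem_compl_iff, not_or, not_not] at hx
    exact hne (h.eq_of_mem hC hD hx.2 hx.1)
  have h0 : ν C (Dᶜ ∪ Cᶜ) = 0 :=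
    measure_union_null (hν ▸ h.compl_eq_zero D hD) (h.compl_eq_zero C hC)
  rw [hdisj, measure_univ] at h0
  exact one_ne_zero h0

end Basic

variable {X : Type*} [MetricSpace X] [CompactSpace X] [MeasurableSpace X] [BorelSpace X]
  {Φ : X → X} {P : Set (Set X)} {ν : Set X → Measure X}

/-- A closed invariant set that meets a class `C` contains it: a continuous function vanishing
on the set has zero averages along its orbits, so its integral with respect to `ν C` is zero. -/
theorem subset_of_closed_invariant (h : IsGenericPartition Φ P ν) {C N : Set X} (hC : C ∈ P)
    (hN : IsClosed N) (hinv : Φ ⁻¹' N = N) (hCN : (C ∩ N).Nonempty) : C ⊆ N := by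
  obtain ⟨x, hxC, hxN⟩ := hCN
  intro q hq
  by_contra hqN
  have := h.prob C hC
  obtain ⟨g, hg0, hg1, hg⟩ := exists_continuous_zero_one_of_isClosed hN
    (isClosed_singleton (x := q))
    (disjoint_singleton_right.2 hqN)
  have horb : ∀ n, Φ^[n] x ∈ N := fun n => by
    induction n with
    | zero => exact hxN
    | succ n ih => rw [Function.iterate_succ_apply', ← mem_preimage, hinv]; exact ih
  have hav : ∀ n, birkhoffAverage ℝ Φ g n x = 0 := fun n => by
    simp only [birkhoffAverage, birkhoffSum]
    rw [Finset.sum_eq_zero fun i _ => hg0 (horb i), smul_zero]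
  have hint : ∫ z, g z ∂ν C = 0 := by
    refine tendsto_nhds_unique (h.generic C hC x hxC g) ?_
    simp only [hav, tendsto_const_nhds]
  have hae := (integral_eq_zero_iff_of_nonneg (fun z => (hg z).1)
    (integrable_continuousMap (ν C) g)).1 hint
  refine h.open_ne_zero C hC {z | g z ≠ 0} (isOpen_ne_fun g.continuous continuous_const)
    ⟨q, hq, ?_⟩ hae
  have : g q = 1 := hg1 rfl
  simp [this]

theorem setOf_isMinimalComponent (h : IsGenericPartition Φ P ν) :
    {M | IsMinimalComponent Φ M} = P := by
  have key : ∀ C ∈ P, IsMinimalComponent Φ C := fun C hC =>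
    ⟨h.nonempty hC, h.isClosed C hC, h.preimage_eq C hC, fun N hN hne hcl hinv =>
      hN.antisymm (h.subset_of_closed_invariant hC hcl hinv (by rwa [inter_eq_right.2 hN]))⟩
  refine Subset.antisymm ?_ key
  rintro M ⟨⟨x, hx⟩, hcl, hinv, hmin⟩
  obtain ⟨C, hC, hxC⟩ := h.exists_mem x
  have hCM := h.subset_of_closed_invariant hC hcl hinv ⟨x, hxC, hx⟩
  rwa [← hmin C hCM (h.nonempty hC) (h.isClosed C hC) (h.preimage_eq C hC)]

theorem measurePreserving (h : IsGenericPartition Φ P ν) (hΦ : Continuous Φ) {C : Set X}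
    (hC : C ∈ P) :
    MeasurePreserving Φ (ν C) (ν C) := by
  have := h.prob C hC
  obtain ⟨x, hx⟩ := h.nonempty hC
  exact (h.generic C hC x hx).measurePreserving hΦ

theorem eq_measure (h : IsGenericPartition Φ P ν) (hΦ : Continuous Φ) {C : Set X}
    (hC : C ∈ P) {μ : Measure X} [IsProbabilityMeasure μ] (hμ : MeasurePreserving Φ μ μ)
    (h0 : μ Cᶜ = 0) : μ = ν C := by
  have := h.prob C hC
  refine eq_of_ae_isGeneric hΦ hμ ?_
  filter_upwards [compl_mem_ae_iff.2 h0] with x hx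
  exact h.generic C hC x (not_not.1 hx)

theorem isUniquelyErgodicOn (h : IsGenericPartition Φ P ν) (hΦ : Continuous Φ) {C : Set X}
    (hC : C ∈ P) :
    IsUniquelyErgodicOn Φ C :=
  ⟨ν C, ⟨h.prob C hC, h.measurePreserving hΦ hC, h.compl_eq_zero C hC⟩,
    fun _ ⟨_, hμ, h0⟩ => h.eq_measure hΦ hC hμ h0⟩

theorem ergodic (h : IsGenericPartition Φ P ν) (hΦ : Continuous Φ) {C : Set X}
    (hC : C ∈ P) : Ergodic Φ (ν C) := by
  have := h.prob C hC
  have hmp := h.measurePreserving hΦ hC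
  refine ⟨hmp, ⟨fun s hs hinv => ?_⟩⟩
  rw [eventuallyConst_set]
  by_cases h0 : ν C s = 0
  · exact Or.inr (measure_eq_zero_iff_ae_notMem.1 h0)
  -- the conditional measure of `ν C` on `s` is invariant and carried by `C`, so it is `ν C`
  · left
    have hprob := ProbabilityTheory.cond_isProbabilityMeasure (μ := ν C) h0
    have hcond : MeasurePreserving Φ (ProbabilityTheory.cond (ν C) s)
        (ProbabilityTheory.cond (ν C) s) := by
      have := (hmp.restrict_preimage hs).smul_measure (ν C s)⁻¹
      rwa [hinv] at this
    have hcompl : ProbabilityTheory.cond (ν C) s Cᶜ = 0 :=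
      ProbabilityTheory.cond_absolutelyContinuous (h.compl_eq_zero C hC)
    have heq := h.eq_measure hΦ hC hcond hcompl
    rw [ae_iff]
    change ν C sᶜ = 0
    rw [← heq, ProbabilityTheory.cond_apply hs]
    simp

theorem setOf_isGeneric {X : Type*} [MetricSpace X] [MeasurableSpace X] [BorelSpace X] {Φ : X → X}
    {P : Set (Set X)} {ν : Set X → Measure X} (h : IsGenericPartition Φ P ν) {C : Set X} (hC : C ∈ P) :
    {x | IsGeneric Φ (ν C) x} = C := by
  refine Subset.antisymm (fun x hx => ?_) (h.generic C hC)
  obtain ⟨D, hD, hxD⟩ := h.exists_mem x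
  have := h.prob C hC
  have := h.prob D hD
  rwa [h.eq_of_measure_eq hC hD (IsGeneric.measure_unique hx (h.generic D hD x hxD))]

/-- The limits of the ergodic averages of countably many dense continuous functions are Borel
functions, constant on the classes, which separate the classes. -/
theorem isMeasurablePartition (h : IsGenericPartition Φ P ν) (hΦ : Continuous Φ) :
    IsMeasurablePartition P := by
  choose c hcP hc using h.exists_mem
  have hcC : ∀ C ∈ P, ∀ x ∈ C, c x = C := fun C hC x hx => h.eq_of_mem (hcP x) hC (hc x) hx
  refine ⟨h.isPartition, ?_⟩
  by_cases hX : Nonempty X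
  swap
  · refine ⟨fun _ => ∅, fun _ => .empty, fun _ _ _ => Or.inr (disjoint_empty _), fun C hC => ?_⟩
    exact absurd ⟨(h.nonempty hC).some⟩ hX
  obtain ⟨G, hG⟩ := TopologicalSpace.exists_dense_seq C(X, ℝ)
  let L : ℕ → X → ℝ := fun k x => ∫ z, G k z ∂ν (c x)
  have hL : ∀ k, Measurable (L k) := fun k =>
    measurable_of_tendsto_metrizable
      (fun n => (continuous_birkhoffAverage hΦ (G k) n).measurable)
      (tendsto_pi_nhds.2 fun x => h.generic _ (hcP x) x (hc x) (G k))
  let B : ℕ × ℚ → Set X := fun i => {x | L i.1 x < i.2}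
  have hsat : ∀ i, ∀ C ∈ P, C ⊆ B i ∨ Disjoint C (B i) := fun i C hC => by
    by_cases hlt : ∫ z, G i.1 z ∂ν C < i.2
    · exact Or.inl fun x hx => by simpa [B, L, hcC C hC x hx] using hlt
    · refine Or.inr (disjoint_left.2 fun x hx hxB => hlt ?_)
      simpa [B, L, hcC C hC x hx] using hxB
  have hsep : ∀ C ∈ P, ∀ D ∈ P, ∀ k, ∫ z, G k z ∂ν C < ∫ z, G k z ∂ν D →
      ∃ i, C ⊆ B i ∧ Disjoint D (B i) := fun C hC D hD k hlt => by
    obtain ⟨q, hq₁, hq₂⟩ := exists_rat_btwn hlt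
    refine ⟨(k, q), fun x hx => by simpa [B, L, hcC C hC x hx] using hq₁, ?_⟩
    refine disjoint_left.2 fun x hx hxB => hq₂.not_gt ?_
    simpa [B, L, hcC D hD x hx] using hxB
  obtain ⟨e, he⟩ := exists_surjective_nat (ℕ × ℚ)
  refine ⟨B ∘ e, fun n => ?_, fun n => hsat (e n), fun C hC D hD hne => ?_⟩
  · exact measurableSet_lt (hL _) measurable_const
  have := h.prob C hC
  have := h.prob D hD
  have hk : ∃ k, ∫ z, G k z ∂ν C ≠ ∫ z, G k z ∂ν D := by
    by_contra! hall
    refine hne (h.eq_of_measure_eq hC hD (measure_ext_of_integral_continuousMap fun g => ?_))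
    have hcont : ∀ μ : Measure X, IsFiniteMeasure μ →
        Continuous fun g : C(X, ℝ) => ∫ z, g z ∂μ := fun μ _ => by
      have := (continuous_integral (μ := μ) (G := ℝ)).comp
        (ContinuousMap.toLp (E := ℝ) 1 μ ℝ).continuous
      refine this.congr fun g => ?_
      exact integral_congr_ae (ContinuousMap.coeFn_toLp (𝕜 := ℝ) μ g)
    exact congrFun (hG.equalizer (hcont _ inferInstance) (hcont _ inferInstance) (funext hall)) g
  obtain ⟨k, hk⟩ := hk
  rcases lt_or_gt_of_ne hk with hlt | hlt
  · obtain ⟨i, hi⟩ := hsep C hC D hD k hlt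
    obtain ⟨n, rfl⟩ := he i
    exact ⟨n, Or.inl hi⟩
  · obtain ⟨i, hi⟩ := hsep D hD C hC k hlt
    obtain ⟨n, rfl⟩ := he i
    exact ⟨n, Or.inr hi⟩

/-- By ergodicity each set of a separating sequence, or its complement, has full measure; the
intersection of these sets is contained in one class, which then carries the measure. -/
theorem exists_eq_of_ergodic (h : IsGenericPartition Φ P ν) (hΦ : Continuous Φ)
    {μ : Measure X} [IsProbabilityMeasure μ] (hμ : Ergodic Φ μ) : ∃ C ∈ P, μ = ν C := by
  obtain ⟨-, B, hB, hsat, hsep⟩ := h.isMeasurablePartition hΦ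
  have hinv : ∀ n, Φ ⁻¹' B n = B n := fun n =>
    preimage_eq_of_saturated h.isPartition h.preimage_eq (hsat n)
  let S : ℕ → Set X := fun n => {x | x ∈ B n ↔ ∀ᵐ y ∂μ, y ∈ B n}
  have hS : ∀ n, ∀ᵐ x ∂μ, x ∈ S n := fun n => by
    rcases eventuallyConst_set.1 (hμ.aeconst_set (hB n) (hinv n)) with h' | h'
    · filter_upwards [h'] with x hx using ⟨fun _ => h', fun _ => hx⟩
    · filter_upwards [h'] with x hx using
        ⟨fun hx' => (hx hx').elim, fun h'' => (by
          obtain ⟨y, hy₁, hy₂⟩ := (h'.and h'').exists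
          exact (hy₁ hy₂).elim)⟩
  have hall := ae_all_iff.2 hS
  obtain ⟨x, hx⟩ := hall.exists
  obtain ⟨C, hC, hxC⟩ := h.exists_mem x
  refine ⟨C, hC, h.eq_measure hΦ hC hμ.toMeasurePreserving ?_⟩
  have : ∀ᵐ y ∂μ, y ∈ C := by
    filter_upwards [hall] with y hy
    obtain ⟨D, hD, hyD⟩ := h.exists_mem y
    by_contra hyC
    have hne : C ≠ D := fun h' => hyC (h' ▸ hyD)
    have hxy : ∀ n, x ∈ B n ↔ y ∈ B n := fun n => (hx n).trans (hy n).symm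
    obtain ⟨n, ⟨h₁, h₂⟩ | ⟨h₁, h₂⟩⟩ := hsep C hC D hD hne
    · exact disjoint_left.1 h₂ hyD ((hxy n).1 (h₁ hxC))
    · exact disjoint_left.1 h₂ hxC ((hxy n).2 (h₁ hyD))
  exact ae_iff.1 this

theorem ergodicComponents_eq (h : IsGenericPartition Φ P ν) (hΦ : Continuous Φ) :
    ergodicComponents Φ = P := by
  ext C
  constructor
  · rintro ⟨μ, hprob, hμ, rfl⟩
    obtain ⟨C, hC, rfl⟩ := h.exists_eq_of_ergodic hΦ hμ
    rwa [h.setOf_isGeneric hC]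
  · exact fun hC => ⟨ν C, h.prob C hC, h.ergodic hΦ hC, (h.setOf_isGeneric hC).symm⟩

/-- An invariant Borel set agrees almost everywhere with a union of classes: its indicator is an
`L¹`-limit of continuous functions `g`, hence of the limits of their ergodic averages, and these
are constant on the classes. -/
theorem exists_ae_saturated (h : IsGenericPartition Φ P ν) (hΦ : Continuous Φ)
    {μ : Measure X} [IsProbabilityMeasure μ]
    (hμ : MeasurePreserving Φ μ μ) {B : Set X} (hB : MeasurableSet B) (hinv : Φ ⁻¹' B = B) :
    ∃ E : Set X, μ Eᶜ = 0 ∧ ∀ C ∈ P, ∀ x ∈ C ∩ E, ∀ y ∈ C ∩ E, x ∈ B → y ∈ B := by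
  choose c hcP hc using h.exists_mem
  have hcC : ∀ C ∈ P, ∀ x ∈ C, c x = C := fun C hC x hx => h.eq_of_mem (hcP x) hC (hc x) hx
  let f : X → ℝ := B.indicator 1
  have hf : Integrable f μ := (integrable_const (1 : ℝ)).indicator hB
  have hfinv : ∀ i x, f (Φ^[i] x) = f x := fun i x => by
    have hi : Φ^[i] ⁻¹' B = B := by
      induction i with
      | zero => rfl
      | succ i ih => rw [Function.iterate_succ, preimage_comp, ih, hinv]
    have hx : Φ^[i] x ∈ B ↔ x ∈ B := by rw [← mem_preimage, hi]
    by_cases hxB : x ∈ B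
    · simp [f, hxB, hx.2 hxB]
    · simp [f, hxB, mt hx.1 hxB]
  have happ : ∀ k : ℕ, ∃ g : C(X, ℝ), ∫⁻ x, ‖f x - g x‖ₑ ∂μ ≤ ((k : ENNReal) + 1)⁻¹ := fun k => by
    obtain ⟨g, hg, -⟩ := hf.exists_boundedContinuous_lintegral_sub_le (ε := ((k : ENNReal) + 1)⁻¹)
      (by simp)
    exact ⟨g.toContinuousMap, hg⟩
  choose g hg using happ
  let L : ℕ → X → ℝ := fun k x => ∫ z, g k z ∂ν (c x)
  have hlim : ∀ k x, Tendsto (fun n => birkhoffAverage ℝ Φ (g k) n x) atTop (𝓝 (L k x)) :=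
    fun k x => h.generic _ (hcP x) x (hc x) (g k)
  have hL : ∀ k, Measurable (L k) := fun k =>
    measurable_of_tendsto_metrizable
      (fun n => (continuous_birkhoffAverage hΦ (g k) n).measurable)
      (tendsto_pi_nhds.2 fun x => hlim k x)
  have hbound : ∀ k, ∫⁻ x, ‖f x - L k x‖ₑ ∂μ ≤ ((k : ENNReal) + 1)⁻¹ := fun k => by
    have hfat : ∫⁻ x, ‖f x - L k x‖ₑ ∂μ ≤
        liminf (fun n => ∫⁻ x, ‖f x - birkhoffAverage ℝ Φ (g k) n x‖ₑ ∂μ) atTop := by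
      refine le_trans (lintegral_mono fun x => ?_) (lintegral_liminf_le' fun n => ?_)
      · exact ((tendsto_const_nhds.sub (hlim k x)).enorm).liminf_eq.ge
      · exact (hf.aestronglyMeasurable.sub
          (continuous_birkhoffAverage hΦ (g k) n).aestronglyMeasurable).enorm
    refine hfat.trans (liminf_le_of_frequently_le' (Eventually.frequently ?_))
    filter_upwards [eventually_ne_atTop 0] with n hn
    have hpt : ∀ x, ‖f x - birkhoffAverage ℝ Φ (g k) n x‖ₑ ≤
        (n : ENNReal)⁻¹ * ∑ i ∈ Finset.range n, ‖f (Φ^[i] x) - g k (Φ^[i] x)‖ₑ := fun x => by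
      have hn' : (n : ℝ) ≠ 0 := by exact_mod_cast hn
      have : f x - birkhoffAverage ℝ Φ (g k) n x =
          (n : ℝ)⁻¹ * ∑ i ∈ Finset.range n, (f (Φ^[i] x) - g k (Φ^[i] x)) := by
        simp only [birkhoffAverage, birkhoffSum, smul_eq_mul, Finset.sum_sub_distrib, hfinv,
          Finset.sum_const, Finset.card_range, nsmul_eq_mul]
        field_simp
      rw [this, enorm_mul]
      gcongr
      · rw [enorm_inv hn']; simp
      · exact enorm_sum_le _ _
    have hm : Measurable fun x => ‖f x - g k x‖ₑ :=
      ((measurable_one.indicator hB).sub (g k).continuous.measurable).enorm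
    calc ∫⁻ x, ‖f x - birkhoffAverage ℝ Φ (g k) n x‖ₑ ∂μ
        ≤ ∫⁻ x, (n : ENNReal)⁻¹ * ∑ i ∈ Finset.range n, ‖f (Φ^[i] x) - g k (Φ^[i] x)‖ₑ ∂μ :=
          lintegral_mono hpt
      _ = (n : ENNReal)⁻¹ * ∑ i ∈ Finset.range n, ∫⁻ x, ‖f (Φ^[i] x) - g k (Φ^[i] x)‖ₑ ∂μ := by
          rw [lintegral_const_mul' _ _ (by simp [hn]), lintegral_finsetSum]
          exact fun i _ => hm.comp (hμ.iterate i).measurable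
      _ = (n : ENNReal)⁻¹ * ∑ i ∈ Finset.range n, ∫⁻ x, ‖f x - g k x‖ₑ ∂μ := by
          congr 1
          exact Finset.sum_congr rfl fun i _ => (hμ.iterate i).lintegral_comp hm
      _ = ∫⁻ x, ‖f x - g k x‖ₑ ∂μ := by
          rw [Finset.sum_const, Finset.card_range, nsmul_eq_mul, ← mul_assoc,
            ENNReal.inv_mul_cancel (by exact_mod_cast hn) (by simp), one_mul]
      _ ≤ _ := hg k
  have htends : TendstoInMeasure μ L atTop f := by
    refine tendstoInMeasure_of_tendsto_eLpNorm (p := 1) one_ne_zero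
      (fun k => (hL k).aestronglyMeasurable) hf.aestronglyMeasurable ?_
    have h0 : Tendsto (fun k : ℕ => ((k : ENNReal) + 1)⁻¹) atTop (𝓝 0) := by
      have := (tendsto_add_atTop_iff_nat 1).2 ENNReal.tendsto_inv_nat_nhds_zero
      simpa using this
    refine tendsto_of_tendsto_of_tendsto_of_le_of_le tendsto_const_nhds h0 (fun _ => zero_le)
      fun k => ?_
    simp only [eLpNorm_one_eq_lintegral_enorm, Pi.sub_apply]
    refine le_trans (le_of_eq (lintegral_congr fun x => ?_)) (hbound k)
    rw [← enorm_neg, neg_sub]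
  obtain ⟨ns, -, hns⟩ := htends.exists_seq_tendsto_ae
  refine ⟨{x | Tendsto (fun i => L (ns i) x) atTop (𝓝 (f x))}, ae_iff.1 hns, ?_⟩
  rintro C hC x ⟨hxC, hxE⟩ y ⟨hyC, hyE⟩ hxB
  have hLxy : ∀ k, L k x = L k y := fun k => by
    simp only [L, hcC C hC x hxC, hcC C hC y hyC]
  simp only [mem_ofPred_eq, hLxy] at hxE hyE
  have hfxy : f x = f y := tendsto_nhds_unique hxE hyE
  by_contra hyB
  simp [f, hxB, hyB] at hfxy

theorem isErgodicPartition (h : IsGenericPartition Φ P ν) (hΦ : Continuous Φ)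
    {μ : Measure X} [IsProbabilityMeasure μ]
    (hμ : MeasurePreserving Φ μ μ) : IsErgodicPartition Φ μ P := by
  refine ⟨⟨h.isMeasurablePartition hΦ, h.preimage_eq⟩, fun Q hQ hQinv => ?_⟩
  obtain ⟨hQpart, B, hB, hsat, hsep⟩ := hQ
  have hinv : ∀ n, Φ ⁻¹' B n = B n := fun n =>
    preimage_eq_of_saturated hQpart hQinv (hsat n)
  choose E hE hEsat using fun n => h.exists_ae_saturated hΦ hμ (hB n) (hinv n)
  refine ⟨⋂ n, E n, ?_, fun C hC => ?_⟩
  · rw [compl_iInter]; exact measure_iUnion_null hE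
  by_cases hne : (C ∩ ⋂ n, E n).Nonempty
  · obtain ⟨x, hxC, hxE⟩ := hne
    obtain ⟨D, ⟨hD, hxD⟩, -⟩ := hQpart.2 x
    refine ⟨D, hD, fun y ⟨hyC, hyE⟩ => ?_⟩
    obtain ⟨D', ⟨hD', hyD'⟩, -⟩ := hQpart.2 y
    by_contra hyD
    have hDD : D ≠ D' := fun h' => hyD (h' ▸ hyD')
    rw [mem_iInter] at hxE hyE
    obtain ⟨n, ⟨h₁, h₂⟩ | ⟨h₁, h₂⟩⟩ := hsep D hD D' hD' hDD
    · exact disjoint_left.1 h₂ hyD'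
        (hEsat n C hC x ⟨hxC, hxE n⟩ y ⟨hyC, hyE n⟩ (h₁ hxD))
    · exact disjoint_left.1 h₂ hxD
        (hEsat n C hC y ⟨hyC, hyE n⟩ x ⟨hxC, hxE n⟩ (h₁ hyD'))
  · obtain ⟨x, hx⟩ := h.nonempty hC
    obtain ⟨D, ⟨hD, -⟩, -⟩ := hQpart.2 x
    exact ⟨D, hD, fun y hy => (hne ⟨y, hy⟩).elim⟩

end IsGenericPartition

/-! ### Exponential sums with linear and quadratic phases -/

section ExponentialSums

open ComplexConjugate

theorem toCircle_ne_one {A : UnitAddCircle} (hA : A ≠ 0) : (A.toCircle : ℂ) ≠ 1 := fun h =>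
  hA (AddCircle.injective_toCircle one_ne_zero
    (by rw [AddCircle.toCircle_zero]; exact Subtype.ext h))

theorem tendsto_average_linear_phase (c : UnitAddCircle) {A : UnitAddCircle} (hA : A ≠ 0) :
    Tendsto (fun N : ℕ => (N : ℂ)⁻¹ * ∑ n ∈ Finset.range N, ((c + n • A).toCircle : ℂ))
      atTop (𝓝 0) := by
  set z : ℂ := (A.toCircle : ℂ) with hz
  have hz1 : z ≠ 1 := toCircle_ne_one hA
  have hsum : ∀ N : ℕ, ∑ n ∈ Finset.range N, ((c + n • A).toCircle : ℂ) =
      c.toCircle * ((z ^ N - 1) / (z - 1)) := fun N => by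
    rw [← geom_sum_eq hz1, Finset.mul_sum]
    refine Finset.sum_congr rfl fun n _ => ?_
    rw [AddCircle.toCircle_add, AddCircle.toCircle_nsmul]
    push_cast; rfl
  refine squeeze_zero_norm (a := fun N : ℕ => (N : ℝ)⁻¹ * (2 / ‖z - 1‖)) (fun N => ?_) ?_
  · rw [hsum, norm_mul, norm_mul, norm_div, norm_inv, RCLike.norm_natCast, Circle.norm_coe, one_mul]
    gcongr
    refine (norm_sub_le _ _).trans ?_
    rw [norm_pow, Circle.norm_coe]
    norm_num
  · simpa using tendsto_inv_atTop_nhds_zero_nat.mul_const (2 / ‖z - 1‖)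

/-- A van der Corput lemma: the averages of a unimodular sequence tend to zero if the averaged
correlations of its distinct translates do. For each `H`, the average over `n < N` differs from
that of `H⁻¹ ∑ h < H, u (n + h)` by `O (H / N)`, and the mean square of the latter tends to
`H⁻¹`. -/
theorem tendsto_average_of_correlation {u : ℕ → ℂ} (hu : ∀ n, ‖u n‖ = 1)
    (hcor : ∀ h k, h ≠ k → Tendsto
      (fun N : ℕ => (N : ℂ)⁻¹ * ∑ n ∈ Finset.range N, u (n + h) * conj (u (n + k))) atTop (𝓝 0)) :
    Tendsto (fun N : ℕ => (N : ℂ)⁻¹ * ∑ n ∈ Finset.range N, u n) atTop (𝓝 0) := by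
  have hshift : ∀ h N : ℕ, ‖∑ n ∈ Finset.range N, u n - ∑ n ∈ Finset.range N, u (n + h)‖ ≤ 2 * h :=
    fun h N => by
    have hle : ∀ v : ℕ → ℂ, (∀ n, ‖v n‖ = 1) → ‖∑ n ∈ Finset.range h, v n‖ ≤ h := fun v hv => by
      refine (norm_sum_le _ _).trans ?_
      simp [hv]
    have h₁ := Finset.sum_range_add u N h
    have h₂ := Finset.sum_range_add u h N
    rw [add_comm h N] at h₂
    have h₃ : ∑ n ∈ Finset.range N, u n - ∑ n ∈ Finset.range N, u (n + h) =
        ∑ n ∈ Finset.range h, u n - ∑ n ∈ Finset.range h, u (N + n) := by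
      simp only [add_comm _ h]
      linear_combination h₂ - h₁
    rw [h₃]
    refine (norm_sub_le _ _).trans ?_
    linarith [hle u hu, hle (fun n => u (N + n)) fun n => hu _]
  let V : ℕ → ℕ → ℂ := fun H n => ∑ h ∈ Finset.range H, u (n + h)
  have hV : ∀ H : ℕ, Tendsto (fun N : ℕ => (N : ℝ)⁻¹ * ∑ n ∈ Finset.range N, ‖V H n‖ ^ 2)
      atTop (𝓝 H) := fun H => by
    have hexp : ∀ N : ℕ, (((N : ℝ)⁻¹ * ∑ n ∈ Finset.range N, ‖V H n‖ ^ 2 : ℝ) : ℂ) =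
        ∑ h ∈ Finset.range H, ∑ k ∈ Finset.range H,
          (N : ℂ)⁻¹ * ∑ n ∈ Finset.range N, u (n + h) * conj (u (n + k)) := fun N => by
      push_cast
      simp only [← Finset.mul_sum]
      congr 1
      simp only [← Complex.mul_conj', V, map_sum, Finset.sum_mul_sum]
      rw [Finset.sum_comm]
      refine Finset.sum_congr rfl fun h _ => ?_
      rw [Finset.sum_comm]
    have hlim : Tendsto (fun N : ℕ => ∑ h ∈ Finset.range H, ∑ k ∈ Finset.range H,
        (N : ℂ)⁻¹ * ∑ n ∈ Finset.range N, u (n + h) * conj (u (n + k))) atTop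
        (𝓝 (∑ h ∈ Finset.range H, ∑ k ∈ Finset.range H, if h = k then 1 else 0)) := by
      refine tendsto_finsetSum _ fun h _ => tendsto_finsetSum _ fun k _ => ?_
      split_ifs with hhk
      · subst hhk
        refine tendsto_const_nhds.congr' ?_
        filter_upwards [eventually_ne_atTop 0] with N hN
        have hN' : (N : ℂ) ≠ 0 := by exact_mod_cast hN
        simp [Complex.mul_conj', hu, hN']
      · exact hcor h k hhk
    have hval : (∑ h ∈ Finset.range H, ∑ k ∈ Finset.range H, if h = k then (1 : ℂ) else 0) = H := by
      have : ∀ h ∈ Finset.range H, (∑ k ∈ Finset.range H, if h = k then (1 : ℂ) else 0) = 1 :=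
        fun h hh => by simp [Finset.mem_range.1 hh]
      rw [Finset.sum_congr rfl this]
      simp
    rw [hval] at hlim
    have := (Complex.continuous_re.tendsto _).comp hlim
    simp only [Complex.natCast_re] at this
    refine this.congr fun N => ?_
    rw [Function.comp_apply, ← hexp, Complex.ofReal_re]
  have hmain : ∀ H N : ℕ, H ≠ 0 → N ≠ 0 →
      ‖(N : ℂ)⁻¹ * ∑ n ∈ Finset.range N, u n‖ ^ 2 ≤ 2 * (2 * H * (N : ℝ)⁻¹) ^ 2 +
        2 * ((H : ℝ)⁻¹ ^ 2 * ((N : ℝ)⁻¹ * ∑ n ∈ Finset.range N, ‖V H n‖ ^ 2)) := fun H N hH hN => by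
    have hH' : (0 : ℝ) < H := by exact_mod_cast Nat.pos_of_ne_zero hH
    have hN' : (0 : ℝ) < N := by exact_mod_cast Nat.pos_of_ne_zero hN
    set S := ∑ n ∈ Finset.range N, u n with hS
    have h₁ : ‖H * S - ∑ n ∈ Finset.range N, V H n‖ ≤ H * (2 * H) := by
      have : H * S - ∑ n ∈ Finset.range N, V H n =
          ∑ h ∈ Finset.range H, (S - ∑ n ∈ Finset.range N, u (n + h)) := by
        rw [Finset.sum_sub_distrib, Finset.sum_const, Finset.card_range, nsmul_eq_mul,
          Finset.sum_comm]
      rw [this]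
      refine (norm_sum_le_of_le _ (n := fun _ => 2 * (H : ℝ)) fun h hh => (hshift h N).trans ?_).trans
        (by simp)
      have : (h : ℝ) ≤ H := by exact_mod_cast (Finset.mem_range.1 hh).le
      linarith
    have h₂ : H * ‖S‖ ≤ H * (2 * H) + ∑ n ∈ Finset.range N, ‖V H n‖ := by
      have h₃ : ‖(H : ℂ) * S‖ ≤ ‖H * S - ∑ n ∈ Finset.range N, V H n‖ +
          ‖∑ n ∈ Finset.range N, V H n‖ := by
        simpa using norm_add_le (H * S - ∑ n ∈ Finset.range N, V H n) (∑ n ∈ Finset.range N, V H n)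
      rw [norm_mul, RCLike.norm_natCast] at h₃
      linarith [norm_sum_le (Finset.range N) (V H)]
    have h₄ : (∑ n ∈ Finset.range N, ‖V H n‖) ^ 2 ≤ N * ∑ n ∈ Finset.range N, ‖V H n‖ ^ 2 := by
      simpa using sq_sum_le_card_mul_sum_sq (s := Finset.range N) (f := fun n => ‖V H n‖)
    have h₅ : ‖S‖ ≤ 2 * H + (H : ℝ)⁻¹ * ∑ n ∈ Finset.range N, ‖V H n‖ := by
      rw [← mul_le_mul_iff_right₀ hH', mul_add, mul_inv_cancel_left₀ hH'.ne']
      exact h₂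
    calc ‖(N : ℂ)⁻¹ * S‖ ^ 2 = ((N : ℝ)⁻¹ * ‖S‖) ^ 2 := by
          rw [norm_mul, norm_inv, RCLike.norm_natCast]
      _ ≤ (2 * H * (N : ℝ)⁻¹ + (N : ℝ)⁻¹ * ((H : ℝ)⁻¹ * ∑ n ∈ Finset.range N, ‖V H n‖)) ^ 2 := by
          refine pow_le_pow_left₀ (by positivity) ?_ 2
          have := mul_le_mul_of_nonneg_left h₅ (inv_nonneg.2 hN'.le)
          linarith
      _ ≤ 2 * (2 * H * (N : ℝ)⁻¹) ^ 2 +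
          2 * ((N : ℝ)⁻¹ * ((H : ℝ)⁻¹ * ∑ n ∈ Finset.range N, ‖V H n‖)) ^ 2 := by
          rw [← mul_add]; exact add_sq_le
      _ = 2 * (2 * H * (N : ℝ)⁻¹) ^ 2 +
          2 * ((H : ℝ)⁻¹ ^ 2 * ((N : ℝ)⁻¹ ^ 2 * (∑ n ∈ Finset.range N, ‖V H n‖) ^ 2)) := by ring
      _ ≤ 2 * (2 * H * (N : ℝ)⁻¹) ^ 2 + 2 * ((H : ℝ)⁻¹ ^ 2 *
          ((N : ℝ)⁻¹ ^ 2 * (N * ∑ n ∈ Finset.range N, ‖V H n‖ ^ 2))) := by gcongr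
      _ = _ := by
          congr 3
          field_simp
  rw [tendsto_zero_iff_norm_tendsto_zero, Metric.tendsto_nhds]
  intro ε hε
  obtain ⟨K, hK⟩ := exists_nat_gt (2 / ε ^ 2)
  have hKpos : (0 : ℝ) < K := lt_trans (by positivity) hK
  have hK0 : K ≠ 0 := by rintro rfl; simp at hKpos
  have hlim : Tendsto (fun N : ℕ => 2 * (2 * K * (N : ℝ)⁻¹) ^ 2 +
      2 * ((K : ℝ)⁻¹ ^ 2 * ((N : ℝ)⁻¹ * ∑ n ∈ Finset.range N, ‖V K n‖ ^ 2))) atTop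
      (𝓝 (2 * (2 * K * 0) ^ 2 + 2 * ((K : ℝ)⁻¹ ^ 2 * K))) :=
    (((tendsto_inv_atTop_nhds_zero_nat.const_mul _).pow 2).const_mul 2).add
      (((hV K).const_mul _).const_mul 2)
  have hlt : 2 * (2 * K * 0) ^ 2 + 2 * ((K : ℝ)⁻¹ ^ 2 * K) < ε ^ 2 := by
    have : 2 * (2 * K * 0) ^ 2 + 2 * ((K : ℝ)⁻¹ ^ 2 * K) = 2 / K := by field_simp; ring
    rw [this, div_lt_iff₀ hKpos]
    rwa [div_lt_iff₀ (by positivity), mul_comm] at hK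
  filter_upwards [hlim.eventually_lt_const hlt, eventually_ne_atTop 0] with N hN hN0
  rw [Real.dist_0_eq_abs, abs_norm]
  exact lt_of_pow_lt_pow_left₀ 2 hε.le ((hmain K N hK0 hN0).trans_lt hN)

theorem tendsto_average_quadratic_phase (c A : UnitAddCircle) {B : UnitAddCircle}
    (hB : ∀ n : ℤ, n ≠ 0 → n • B ≠ 0) :
    Tendsto (fun N : ℕ => (N : ℂ)⁻¹ *
      ∑ n ∈ Finset.range N, ((c + n • A + n.choose 2 • B).toCircle : ℂ)) atTop (𝓝 0) := by
  refine tendsto_average_of_correlation (fun n => Circle.norm_coe _) fun h k hhk => ?_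
  have hB' := hB ((h : ℤ) - k) (by omega)
  refine (tendsto_average_linear_phase
    ((h : ℤ) • A - (k : ℤ) • A + h.choose 2 • B - k.choose 2 • B) hB').congr fun N => ?_
  congr 1
  refine Finset.sum_congr rfl fun n _ => ?_
  rw [← Circle.coe_inv_eq_conj, ← AddCircle.toCircle_neg, ← Circle.coe_mul,
    ← AddCircle.toCircle_add]
  have hch : ∀ m : ℕ, ((n + m).choose 2 : ℕ) • B =
      n.choose 2 • B + m.choose 2 • B + ((n : ℤ) * m) • B := fun m => by
    rw [Nat.add_choose_eq, Finset.Nat.sum_antidiagonal_eq_sum_range_succ_mk]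
    simp only [Finset.sum_range_succ, Finset.sum_range_zero, Nat.choose_zero_right,
      Nat.choose_one_right]
    simp only [add_smul, ← natCast_zsmul]
    simp only [Nat.choose_zero_right, Nat.choose_one_right, Nat.reduceSub, Nat.cast_mul]
    module
  rw [hch, hch]
  congr 2
  simp only [← natCast_zsmul]
  push_cast
  module

end ExponentialSums

/-! ### Genericity is detected by characters -/

section Characters

/-- The Stone–Weierstrass theorem for a multiplicative set of functions. -/
theorem dense_span_of_separatesPoints {X : Type*} [TopologicalSpace X] [CompactSpace X]
    (M : Submonoid C(X, ℂ)) (hstar : ∀ f ∈ M, star f ∈ M)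
    (hsep : ∀ x y, x ≠ y → ∃ f ∈ M, f x ≠ f y) :
    Dense (Submodule.span ℂ (M : Set C(X, ℂ)) : Set C(X, ℂ)) := by
  let S : StarSubalgebra ℂ C(X, ℂ) :=
    { toSubalgebra := Algebra.adjoin ℂ M
      star_mem' := by
        change Algebra.adjoin ℂ (M : Set C(X, ℂ)) ≤ star (Algebra.adjoin ℂ M)
        exact Algebra.adjoin_le fun f hf => Algebra.subset_adjoin (hstar f hf) }
  have hS : S.topologicalClosure = ⊤ := by
    refine ContinuousMap.starSubalgebra_topologicalClosure_eq_top_of_separatesPoints S ?_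
    intro x y hxy
    obtain ⟨f, hf, hne⟩ := hsep x y hxy
    exact ⟨f, ⟨f, Algebra.subset_adjoin hf, rfl⟩, hne⟩
  have hspan : (Submodule.span ℂ (M : Set C(X, ℂ)) : Set C(X, ℂ)) = S := by
    have := Algebra.adjoin_eq_span ℂ (M : Set C(X, ℂ))
    rw [Submonoid.closure_eq] at this
    rw [← this]; rfl
  rw [hspan, dense_iff_closure_eq, ← StarSubalgebra.topologicalClosure_coe, hS]
  rfl

variable {X : Type*} [MetricSpace X] [CompactSpace X] [MeasurableSpace X] [BorelSpace X]

/-- Genericity need only be tested on a self-conjugate, multiplicative, separating set of complex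
functions, as its span is dense and the functions with the right averages form a closed subspace. -/
theorem isGeneric_of_submonoid {Φ : X → X} (hΦ : Continuous Φ) {ν : Measure X}
    [IsFiniteMeasure ν] {x : X} (M : Submonoid C(X, ℂ)) (hstar : ∀ f ∈ M, star f ∈ M)
    (hsep : ∀ x y, x ≠ y → ∃ f ∈ M, f x ≠ f y)
    (hM : ∀ f ∈ M, Tendsto (fun N : ℕ => birkhoffAverage ℂ Φ f N x) atTop (𝓝 (∫ z, f z ∂ν))) :
    IsGeneric Φ ν x := by
  have hint : ∀ f : C(X, ℂ), Integrable f ν := fun f =>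
    f.continuous.integrable_of_hasCompactSupport (HasCompactSupport.of_compactSpace _)
  let T : Set C(X, ℂ) :=
    {f | Tendsto (fun N : ℕ => birkhoffAverage ℂ Φ f N x) atTop (𝓝 (∫ z, f z ∂ν))}
  -- averages of `f` along the orbit of `x` are averages of the evaluation at `x` along the orbit
  -- of `f` under composition with `Φ`
  have hclosed : IsClosed T := by
    let F : C(X, X) := ⟨Φ, hΦ⟩
    let U : C(X, ℂ) → C(X, ℂ) := fun f => f.comp F
    have hU : LipschitzWith 1 U := LipschitzWith.of_dist_le_mul fun f g => by
      have : ∀ y, dist (f.comp F y) (g.comp F y) ≤ dist f g := fun y =>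
        ContinuousMap.dist_apply_le_dist (f := f) (g := g) (F y)
      rw [NNReal.coe_one, one_mul]
      exact (ContinuousMap.dist_le dist_nonneg).2 this
    have hev : UniformContinuous fun f : C(X, ℂ) => f x :=
      (ContinuousMap.evalCLM (M := ℂ) ℂ x).uniformContinuous
    have hl : Continuous fun f : C(X, ℂ) => ∫ z, f z ∂ν := by
      have := (continuous_integral (μ := ν) (G := ℂ)).comp
        (ContinuousMap.toLp (E := ℂ) 1 ν ℂ).continuous
      refine this.congr fun g => ?_
      exact integral_congr_ae (ContinuousMap.coeFn_toLp (𝕜 := ℂ) ν g)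
    have hiter : ∀ (n : ℕ) (f : C(X, ℂ)), (U^[n] f) x = f (Φ^[n] x) := fun n => by
      induction n with
      | zero => exact fun f => rfl
      | succ n ih =>
        intro f
        rw [Function.iterate_succ_apply, ih, Function.iterate_succ_apply']
        rfl
    convert! isClosed_setOfPred_tendsto_birkhoffAverage ℂ hU hev hl using 6 with f N
    simp only [birkhoffAverage, birkhoffSum, hiter]
  have hspan : (Submodule.span ℂ (M : Set C(X, ℂ)) : Set C(X, ℂ)) ⊆ T := by
    intro f hf
    refine Submodule.span_induction (p := fun f _ => f ∈ T) (fun f hf => hM f hf) ?_ ?_ ?_ hf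
    · simp [T, birkhoffAverage, birkhoffSum]
    · intro f g _ _ hf hg
      have : Tendsto _ _ _ := Tendsto.add hf hg
      rw [← integral_add (hint f) (hint g)] at this
      refine this.congr fun N => ?_
      simp [birkhoffAverage, birkhoffSum, Finset.sum_add_distrib, mul_add]
    · intro c f _ hf
      have : Tendsto _ _ _ := Tendsto.const_mul c hf
      rw [← integral_const_mul] at this
      refine this.congr fun N => ?_
      simp only [birkhoffAverage, birkhoffSum, ContinuousMap.coe_smul, Pi.smul_apply, smul_eq_mul,
        ← Finset.mul_sum]
      ring
  have hall : ∀ f : C(X, ℂ), f ∈ T := fun f =>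
    closure_minimal hspan hclosed (dense_span_of_separatesPoints M hstar hsep f)
  intro g
  have hg := (Complex.continuous_re.tendsto _).comp
    (hall ((⟨Complex.ofReal, Complex.continuous_ofReal⟩ : C(ℝ, ℂ)).comp g))
  have hre : (∫ z, ((⟨Complex.ofReal, Complex.continuous_ofReal⟩ : C(ℝ, ℂ)).comp g) z ∂ν).re =
      ∫ z, g z ∂ν := by
    change (∫ z, ((g z : ℝ) : ℂ) ∂ν).re = _
    rw [integral_complex_ofReal, Complex.ofReal_re]
  rw [hre] at hg
  refine hg.congr fun N => ?_
  change ((N : ℂ)⁻¹ * ∑ n ∈ Finset.range N, ((g (Φ^[n] x) : ℝ) : ℂ)).re =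
    (N : ℝ)⁻¹ * ∑ n ∈ Finset.range N, g (Φ^[n] x)
  rw [← Complex.ofReal_sum, ← Complex.ofReal_natCast, ← Complex.ofReal_inv, ← Complex.ofReal_mul,
    Complex.ofReal_re]

end Characters

/-! ### Haar measures on cosets of closed subgroups -/

section Coset

variable {G : Type*} [AddCommGroup G] [MetricSpace G] [IsTopologicalAddGroup G] [CompactSpace G]
  [MeasurableSpace G] [BorelSpace G]

/-- The normalized Haar measure of the coset `p + H`: a character trivial on `H` is constant on the
coset, and any other character has integral zero, as translation by some `h ∈ H` multiplies the
integral by a number different from `1`. -/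
theorem exists_measure_coset (H : AddSubgroup G) (hH : IsClosed (H : Set G)) (p : G) :
    ∃ ν : Measure G, IsProbabilityMeasure ν ∧ ν {x | x - p ∈ H}ᶜ = 0 ∧
      (∀ U : Set G, IsOpen U → ({x | x - p ∈ H} ∩ U).Nonempty → ν U ≠ 0) ∧
      ∀ θ : G →+ UnitAddCircle, Continuous θ →
        ((∀ h ∈ H, θ h = 0) → ∫ z, ((θ z).toCircle : ℂ) ∂ν = (θ p).toCircle) ∧
        ((∃ h ∈ H, θ h ≠ 0) → ∫ z, ((θ z).toCircle : ℂ) ∂ν = 0) := by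
  have : CompactSpace H := isCompact_iff_compactSpace.1 hH.isCompact
  let m : Measure H := Measure.addHaarMeasure ⊤
  have hm : IsProbabilityMeasure m := ⟨by
    rw [← TopologicalSpace.PositiveCompacts.coe_top]; exact Measure.addHaarMeasure_self⟩
  let f : H → G := fun h => p + h
  have hf : Continuous f := continuous_const.add continuous_subtype_val
  have hchar : ∀ θ : G →+ UnitAddCircle, Continuous θ → ∫ z, ((θ z).toCircle : ℂ) ∂m.map f =
      (θ p).toCircle * ∫ h : H, ((θ h).toCircle : ℂ) ∂m := fun θ hθ => by
    rw [integral_map hf.aemeasurable, ← integral_const_mul]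
    · refine integral_congr_ae (Eventually.of_forall fun h => ?_)
      simp only [f, map_add, AddCircle.toCircle_add, Circle.coe_mul]
    · exact (continuous_subtype_val.comp
        (AddCircle.continuous_toCircle.comp hθ)).aestronglyMeasurable
  refine ⟨m.map f, Measure.isProbabilityMeasure_map hf.aemeasurable, ?_, ?_, fun θ hθ => ⟨?_, ?_⟩⟩
  · have hcl : IsClosed {x | x - p ∈ H} := hH.preimage (continuous_id.sub continuous_const)
    rw [Measure.map_apply hf.measurable hcl.measurableSet.compl]
    convert measure_empty (μ := m)
    ext h
    simp [f]
  · rintro U hU ⟨x, hx, hxU⟩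
    rw [Measure.map_apply hf.measurable hU.measurableSet]
    refine ((hU.preimage hf).measure_pos m ⟨⟨x - p, hx⟩, ?_⟩).ne'
    simpa [f] using hxU
  · intro h0
    rw [hchar θ hθ]
    have : ∀ h : H, ((θ h).toCircle : ℂ) = 1 := fun h => by
      rw [h0 h h.2, AddCircle.toCircle_zero, Circle.coe_one]
    simp [this]
  · rintro ⟨h, hh, hne⟩
    rw [hchar θ hθ]
    have htr := integral_add_left_eq_self (μ := m) (fun z : H => ((θ z).toCircle : ℂ)) ⟨h, hh⟩
    simp only [AddSubgroup.coe_add, map_add, AddCircle.toCircle_add, Circle.coe_mul] at htr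
    rw [integral_const_mul] at htr
    have h1 := toCircle_ne_one hne
    have : (((θ h).toCircle : ℂ) - 1) * ∫ z : H, ((θ z).toCircle : ℂ) ∂m = 0 := by
      rw [sub_mul, one_mul, htr, sub_self]
    rw [(mul_eq_zero.1 this).resolve_left (sub_ne_zero.2 h1), mul_zero]

/-- A partition into invariant cosets of closed subgroups is generic, with the Haar measures of the
cosets, if sufficiently many characters have quadratic phases along orbits and a character that is
constant along an orbit is constant on the coset containing it. Indeed, a character that is
constant on a coset is constant along its orbits; any other character has integral zero, and its
phase is not constant, so that its averages tend to zero. -/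
theorem exists_isGenericPartition_of_cosets {Φ : G → G} (hΦ : Continuous Φ) {P : Set (Set G)}
    (hP : Setoid.IsPartition P) (hcl : ∀ C ∈ P, IsClosed C) (hinv : ∀ C ∈ P, Φ ⁻¹' C = C)
    (Θ : AddSubgroup (G →+ UnitAddCircle)) (hΘ : ∀ θ ∈ Θ, Continuous θ)
    (hsep : ∀ x y, x ≠ y → ∃ θ ∈ Θ, θ x ≠ θ y)
    (hcoset : ∀ C ∈ P, ∃ H : AddSubgroup G, (∀ x ∈ C, ∀ y, y ∈ C ↔ y - x ∈ H) ∧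
      ∀ x ∈ C, ∀ θ ∈ Θ, ∃ A B : UnitAddCircle, (B ≠ 0 → ∀ n : ℤ, n ≠ 0 → n • B ≠ 0) ∧
        (∀ n : ℕ, θ (Φ^[n] x) = θ x + n • A + n.choose 2 • B) ∧
        (A = 0 → B = 0 → ∀ h ∈ H, θ h = 0)) :
    ∃ ν : Set G → Measure G, IsGenericPartition Φ P ν := by
  let M : Submonoid C(G, ℂ) :=
    { carrier := {f | ∃ θ ∈ Θ, ∀ x, f x = (θ x).toCircle}
      one_mem' := ⟨0, Θ.zero_mem, fun x => by simp⟩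
      mul_mem' := by
        rintro f g ⟨θ, hθ, hf⟩ ⟨θ', hθ', hg⟩
        exact ⟨θ + θ', Θ.add_mem hθ hθ', fun x => by simp [hf, hg, AddCircle.toCircle_add]⟩ }
  have hMstar : ∀ f ∈ M, star f ∈ M := by
    rintro f ⟨θ, hθ, hf⟩
    refine ⟨-θ, Θ.neg_mem hθ, fun x => ?_⟩
    rw [ContinuousMap.star_apply, hf, AddMonoidHom.neg_apply, AddCircle.toCircle_neg,
      Circle.coe_inv_eq_conj]
    rfl
  have hMsep : ∀ x y, x ≠ y → ∃ f ∈ M, f x ≠ f y := fun x y hxy => by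
    obtain ⟨θ, hθ, hne⟩ := hsep x y hxy
    refine ⟨⟨fun x => ((θ x).toCircle : ℂ), continuous_subtype_val.comp
      (AddCircle.continuous_toCircle.comp (hΘ θ hθ))⟩, ⟨θ, hθ, fun x => rfl⟩, fun h => hne ?_⟩
    exact AddCircle.injective_toCircle one_ne_zero (Subtype.ext h)
  have hex : ∀ C ∈ P, ∃ ν : Measure G, IsProbabilityMeasure ν ∧ ν Cᶜ = 0 ∧
      (∀ U : Set G, IsOpen U → (C ∩ U).Nonempty → ν U ≠ 0) ∧ ∀ x ∈ C, IsGeneric Φ ν x := by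
    intro C hC
    obtain ⟨H, hH, hphase⟩ := hcoset C hC
    obtain ⟨p, hp⟩ : C.Nonempty := nonempty_iff_ne_empty.2 fun h => hP.1 (h ▸ hC)
    have hCH : C = {x | x - p ∈ H} := ext fun x => hH p hp x
    have hHcl : IsClosed (H : Set G) := by
      have : (H : Set G) = (fun h => h + p) ⁻¹' C := by
        ext h
        rw [mem_preimage, hH p hp, add_sub_cancel_right, SetLike.mem_coe]
      rw [this]
      exact (hcl C hC).preimage (continuous_id.add continuous_const)
    obtain ⟨ν, hprob, h0, hopen, hint⟩ := exists_measure_coset H hHcl p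
    rw [← hCH] at h0 hopen
    refine ⟨ν, hprob, h0, hopen, fun x hx => isGeneric_of_submonoid hΦ M hMstar hMsep ?_⟩
    rintro f ⟨θ, hθ, hf⟩
    obtain ⟨A, B, hB, hn, hAB⟩ := hphase x hx θ hθ
    simp only [birkhoffAverage, birkhoffSum, hf, smul_eq_mul]
    by_cases hker : ∀ h ∈ H, θ h = 0
    · have hconst : ∀ y ∈ C, θ y = θ p := fun y hy => by
        have := hker _ ((hH p hp y).1 hy)
        rwa [map_sub, sub_eq_zero] at this
      have horb : ∀ n, Φ^[n] x ∈ C := fun n => by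
        induction n with
        | zero => exact hx
        | succ n ih =>
          rw [Function.iterate_succ_apply', ← mem_preimage, hinv C hC]; exact ih
      rw [(hint θ (hΘ θ hθ)).1 hker]
      refine tendsto_const_nhds.congr' ?_
      filter_upwards [eventually_ne_atTop 0] with N hN
      have hN' : (N : ℂ) ≠ 0 := by exact_mod_cast hN
      simp [hconst _ (horb _), hN']
    · push Not at hker
      rw [(hint θ (hΘ θ hθ)).2 hker]
      simp only [hn]
      by_cases hB0 : B = 0
      · have hA : A ≠ 0 := fun hA => by
          obtain ⟨h, hh, hne⟩ := hker
          exact hne (hAB hA hB0 h hh)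
        simpa [hB0] using tendsto_average_linear_phase (θ x) hA
      · exact tendsto_average_quadratic_phase (θ x) A (hB hB0)
  classical
  refine ⟨fun C => if hC : C ∈ P then (hex C hC).choose else 0, hP, hcl, hinv, ?_, ?_, ?_, ?_⟩
  all_goals
    intro C hC
    simp only [dif_pos hC]
  · exact (hex C hC).choose_spec.1
  · exact (hex C hC).choose_spec.2.1
  · exact (hex C hC).choose_spec.2.2.1
  · exact (hex C hC).choose_spec.2.2.2

end Coset

/-! ### Orbits and characters of the affine map -/

theorem iterate_rotation (α : ℝ) (n : ℕ) (x : UnitAddCircle) :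
    (rotation α)^[n] x = x + n • (α : UnitAddCircle) := by
  induction n with
  | zero => simp
  | succ n ih => rw [Function.iterate_succ_apply', ih, rotation, succ_nsmul, add_assoc]

theorem birkhoffSum_rotation_psi (α γ : ℝ) (n : ℕ) (x : UnitAddCircle) :
    birkhoffSum (rotation α) (psi γ) n x =
      n • x + n.choose 2 • (α : UnitAddCircle) + n • (γ : UnitAddCircle) := by
  induction n with
  | zero => simp
  | succ n ih =>
    rw [birkhoffSum_succ, ih, iterate_rotation, psi, Nat.choose_succ_succ' n 1, Nat.choose_one_right]
    module

theorem affineMap_apply (α γ : ℝ) (r s : ℕ) (p : Torus4) : affineMap α γ r s p =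
    ((p.1.1 + r • (α : UnitAddCircle), p.1.2 + s • (α : UnitAddCircle)),
      (p.2.1 + (r • p.1.1 + r.choose 2 • (α : UnitAddCircle) + r • (γ : UnitAddCircle)),
        p.2.2 + (s • p.1.2 + s.choose 2 • (α : UnitAddCircle) + s • (γ : UnitAddCircle)))) := by
  simp only [affineMap, skewProduct, bigPsi, Prod.map, iterate_rotation, birkhoffSum_rotation_psi]
  rfl

theorem continuous_affineMap (α γ : ℝ) (r s : ℕ) : Continuous (affineMap α γ r s) := by
  rw [funext (affineMap_apply α γ r s)]
  fun_prop

theorem iterate_affineMap (α γ : ℝ) (r s : ℕ) (p : Torus4) (n : ℕ) : (affineMap α γ r s)^[n] p =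
    ((p.1.1 + n • r • (α : UnitAddCircle), p.1.2 + n • s • (α : UnitAddCircle)),
      (p.2.1 + n • (r • p.1.1 + r.choose 2 • (α : UnitAddCircle) + r • (γ : UnitAddCircle)) +
          n.choose 2 • r ^ 2 • (α : UnitAddCircle),
        p.2.2 + n • (s • p.1.2 + s.choose 2 • (α : UnitAddCircle) + s • (γ : UnitAddCircle)) +
          n.choose 2 • s ^ 2 • (α : UnitAddCircle))) := by
  induction n with
  | zero => simp
  | succ n ih =>
    rw [Function.iterate_succ_apply', ih, affineMap_apply, Nat.choose_succ_succ' n 1,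
      Nat.choose_one_right]
    refine Prod.ext (Prod.ext ?_ ?_) (Prod.ext ?_ ?_) <;> dsimp only <;> module

/-- The character `m₁ x + m₂ y + j u + k v` of `𝕋⁴`, with values in `𝕋`. -/
def torusChar (m₁ m₂ j k : ℤ) : Torus4 →+ UnitAddCircle :=
  AddMonoidHom.mk' (fun p => m₁ • p.1.1 + m₂ • p.1.2 + j • p.2.1 + k • p.2.2) fun p q => by
    simp only [Prod.fst_add, Prod.snd_add]
    module

theorem torusChar_apply (m₁ m₂ j k : ℤ) (p : Torus4) :
    torusChar m₁ m₂ j k p = m₁ • p.1.1 + m₂ • p.1.2 + j • p.2.1 + k • p.2.2 := rfl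

theorem continuous_torusChar (m₁ m₂ j k : ℤ) : Continuous (torusChar m₁ m₂ j k) := by
  rw [funext (torusChar_apply m₁ m₂ j k)]
  fun_prop

/-- The group of characters of `𝕋⁴`. -/
def torusCharGroup : AddSubgroup (Torus4 →+ UnitAddCircle) where
  carrier := {θ | ∃ m₁ m₂ j k, θ = torusChar m₁ m₂ j k}
  zero_mem' := ⟨0, 0, 0, 0, by ext p; simp [torusChar_apply]⟩
  add_mem' := by
    rintro _ _ ⟨m₁, m₂, j, k, rfl⟩ ⟨m₁', m₂', j', k', rfl⟩
    refine ⟨m₁ + m₁', m₂ + m₂', j + j', k + k', AddMonoidHom.ext fun p => ?_⟩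
    simp only [AddMonoidHom.add_apply, torusChar_apply]
    module
  neg_mem' := by
    rintro _ ⟨m₁, m₂, j, k, rfl⟩
    refine ⟨-m₁, -m₂, -j, -k, AddMonoidHom.ext fun p => ?_⟩
    simp only [AddMonoidHom.neg_apply, torusChar_apply]
    module

theorem torusCharGroup_separates (p q : Torus4) (hpq : p ≠ q) :
    ∃ θ ∈ torusCharGroup, θ p ≠ θ q := by
  by_contra! h
  refine hpq (Prod.ext (Prod.ext ?_ ?_) (Prod.ext ?_ ?_))
  · simpa [torusChar_apply] using h _ ⟨1, 0, 0, 0, rfl⟩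
  · simpa [torusChar_apply] using h _ ⟨0, 1, 0, 0, rfl⟩
  · simpa [torusChar_apply] using h _ ⟨0, 0, 1, 0, rfl⟩
  · simpa [torusChar_apply] using h _ ⟨0, 0, 0, 1, rfl⟩

/-- The linear coefficient of the phase of `torusChar m₁ m₂ j k` along the orbit of `p`. -/
def linearPhase (α γ : ℝ) (r s : ℕ) (m₁ m₂ j k : ℤ) (p : Torus4) : UnitAddCircle :=
  m₁ • r • (α : UnitAddCircle) + m₂ • s • (α : UnitAddCircle) +
    j • (r • p.1.1 + r.choose 2 • (α : UnitAddCircle) + r • (γ : UnitAddCircle)) +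
    k • (s • p.1.2 + s.choose 2 • (α : UnitAddCircle) + s • (γ : UnitAddCircle))

theorem torusChar_iterate (α γ : ℝ) (r s : ℕ) (m₁ m₂ j k : ℤ) (p : Torus4) (n : ℕ) :
    torusChar m₁ m₂ j k ((affineMap α γ r s)^[n] p) = torusChar m₁ m₂ j k p +
      n • linearPhase α γ r s m₁ m₂ j k p +
      n.choose 2 • (j * r ^ 2 + k * s ^ 2) • (α : UnitAddCircle) := by
  rw [iterate_affineMap]
  simp only [torusChar_apply, linearPhase]
  module

theorem torusChar_affineMap (α γ : ℝ) (r s : ℕ) (m₁ m₂ j k : ℤ) (p : Torus4) :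
    torusChar m₁ m₂ j k (affineMap α γ r s p) =
      torusChar m₁ m₂ j k p + linearPhase α γ r s m₁ m₂ j k p := by
  simpa using torusChar_iterate α γ r s m₁ m₂ j k p 1

theorem coe_freq (γ : ℝ) (r s : ℕ) (c₁ : ℝ) : ((freq γ r s c₁ : ℝ) : UnitAddCircle) =
    ((s : ℤ) - r) • (γ : UnitAddCircle) - (r : ℤ) • (c₁ : UnitAddCircle) := by
  rw [← AddCircle.coe_zsmul, ← AddCircle.coe_zsmul, ← AddCircle.coe_sub]
  congr 1
  simp [freq]

theorem choose_two_of_odd (e : ℕ) : (2 * e + 1).choose 2 = e * (2 * e + 1) := by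
  rw [Nat.choose_two_right]
  have : (2 * e + 1) * (2 * e + 1 - 1) = 2 * (e * (2 * e + 1)) := by
    rw [Nat.add_sub_cancel]; ring
  rw [this, Nat.mul_div_cancel_left _ two_pos]

theorem half_sub_of_odd (e f : ℕ) :
    (((2 * e + 1 : ℕ) : ℤ) - ((2 * f + 1 : ℕ) : ℤ)) / 2 = (e : ℤ) - f := by
  push_cast
  omega

/-- The characters without quadratic phase are those with `j = q s²` and `k = -q r²`; on the level
set `s x - r y = -r c₁` their linear phase depends only on `c₁`. -/
theorem linearPhase_eq {α γ : ℝ} {r s : ℕ} (hr : Odd r) (hs : Odd s) {c₁ : ℝ} {p : Torus4}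
    (hp : torusChar s (-r) 0 0 p = -((r : ℤ) • (c₁ : UnitAddCircle))) (m₁ m₂ q : ℤ) :
    linearPhase α γ r s m₁ m₂ (q * s ^ 2) (-(q * r ^ 2)) p =
      (m₁ * r + m₂ * s + q * r * s * (((r : ℤ) - s) / 2)) • (α : UnitAddCircle) +
        (q * r * s) • ((freq γ r s c₁ : ℝ) : UnitAddCircle) := by
  obtain ⟨e, rfl⟩ := hr
  obtain ⟨f, rfl⟩ := hs
  rw [coe_freq, half_sub_of_odd, linearPhase, choose_two_of_odd, choose_two_of_odd]
  rw [torusChar_apply] at hp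
  push_cast at hp ⊢
  linear_combination (norm := module) (q * (2 * (e : ℤ) + 1) * (2 * f + 1)) • hp

theorem eq_zero_of_zsmul_coe_eq_zero {α : ℝ} (hα : Irrational α) {n : ℤ}
    (h : n • (α : UnitAddCircle) = 0) : n = 0 := by
  rw [← AddCircle.coe_zsmul, AddCircle.coe_eq_zero_iff] at h
  obtain ⟨m, hm⟩ := h
  by_contra hn
  refine (hα.intCast_mul hn).ne_int m ?_
  simpa using hm.symm

/-- The relation `j r² + k s² = 0` forces `(j, k)` to be a multiple of `(s², -r²)`. -/
theorem exists_eq_mul_sq {r s : ℕ} (hs : s ≠ 0) (hrs : Nat.Coprime r s) {j k : ℤ}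
    (h : j * r ^ 2 + k * s ^ 2 = 0) : ∃ q : ℤ, j = q * s ^ 2 ∧ k = -(q * r ^ 2) := by
  have hcop : IsCoprime ((s : ℤ) ^ 2) ((r : ℤ) ^ 2) :=
    (Nat.isCoprime_iff_coprime.2 hrs.symm).pow
  obtain ⟨q, hq⟩ : (s : ℤ) ^ 2 ∣ j :=
    hcop.dvd_of_dvd_mul_right ⟨-k, by linear_combination h⟩
  have hs' : (s : ℤ) ^ 2 ≠ 0 := by positivity
  exact ⟨q, by rw [hq]; ring,
    mul_left_cancel₀ hs' (by rw [hq] at h; linear_combination h)⟩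

/-! ### The components as cosets -/

theorem mem_setI_iff {r s : ℕ} {c₁ : ℝ} {p : Torus4} :
    p ∈ setI r s c₁ ↔ torusChar s (-r) 0 0 p = -((r : ℤ) • (c₁ : UnitAddCircle)) := by
  simp only [setI, setA, mem_prod, mem_univ, and_true, torusChar_apply]
  constructor
  · rintro ⟨x, y, hxy, hp⟩
    rw [hp]
    linear_combination (norm := module) hxy
  · intro h
    refine ⟨p.1.1, p.1.2 - c₁, ?_, by simp⟩
    linear_combination (norm := module) h

theorem mem_setJ_iff {r s : ℕ} {a b : ℤ} {l : ℕ} {k : ℤ} {c₁ c₂ : ℝ} {p : Torus4} :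
    p ∈ setJ r s a b l k c₁ c₂ ↔
      torusChar s (-r) 0 0 p = -((r : ℤ) • (c₁ : UnitAddCircle)) ∧
      torusChar (-(((l : ℤ) * r * s * (((r : ℤ) - s) / 2) + k) * a))
          (-(((l : ℤ) * r * s * (((r : ℤ) - s) / 2) + k) * b)) (l * s ^ 2) (-(l * r ^ 2)) p =
        -(((l : ℤ) * r ^ 2) • (c₂ : UnitAddCircle)) -
          (((l : ℤ) * r * s * (((r : ℤ) - s) / 2) + k) * b) • (c₁ : UnitAddCircle) := by
  simp only [setJ, mem_ofPred_eq, torusChar_apply]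
  generalize (l : ℤ) * r * s * (((r : ℤ) - s) / 2) + k = K
  constructor
  · rintro ⟨x, y, u, v, hxy, huv, rfl⟩
    constructor
    · linear_combination (norm := module) hxy
    · linear_combination (norm := module) huv
  · rintro ⟨h₁, h₂⟩
    refine ⟨p.1.1, p.1.2 - c₁, p.2.1, p.2.2 - c₂, ?_, ?_, by simp⟩
    · linear_combination (norm := module) h₁
    · linear_combination (norm := module) h₂

theorem setJ_subset_setI {r s : ℕ} {a b : ℤ} {l : ℕ} {k : ℤ} {c₁ c₂ : ℝ} :
    setJ r s a b l k c₁ c₂ ⊆ setI r s c₁ := fun _ hp => mem_setI_iff.2 (mem_setJ_iff.1 hp).1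

theorem affineMap_mem_setI_iff {α γ : ℝ} {r s : ℕ} {c₁ : ℝ} {p : Torus4} :
    affineMap α γ r s p ∈ setI r s c₁ ↔ p ∈ setI r s c₁ := by
  have : linearPhase α γ r s s (-r) 0 0 p = 0 := by
    simp only [linearPhase]
    module
  rw [mem_setI_iff, mem_setI_iff, torusChar_affineMap, this, add_zero]

/-- The relation between `freq` and `α` expressed by a resonance. -/
theorem IsResonance.zsmul_freq {α γ : ℝ} {r s : ℕ} {c₁ : ℝ} {l : ℕ} {k : ℤ}
    (h : IsResonance α γ r s c₁ l k) :
    ((l : ℤ) * r * s) • ((freq γ r s c₁ : ℝ) : UnitAddCircle) = k • (α : UnitAddCircle) := by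
  obtain ⟨-, m, hm⟩ := h
  rw [← AddCircle.coe_zsmul, ← AddCircle.coe_zsmul, ← sub_eq_zero, ← AddCircle.coe_sub,
    AddCircle.coe_eq_zero_iff]
  refine ⟨m, ?_⟩
  simp only [zsmul_eq_mul, mul_one]
  push_cast
  exact hm.symm

theorem affineMap_mem_setJ_iff {α γ : ℝ} {r s : ℕ} (hr : Odd r) (hs : Odd s) {a b : ℤ}
    (hab : a * r + b * s = 1) {l : ℕ} {k : ℤ} {c₁ c₂ : ℝ} (h : IsResonance α γ r s c₁ l k)
    {p : Torus4} :
    affineMap α γ r s p ∈ setJ r s a b l k c₁ c₂ ↔ p ∈ setJ r s a b l k c₁ c₂ := by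
  rw [mem_setJ_iff, mem_setJ_iff, ← mem_setI_iff, ← mem_setI_iff, affineMap_mem_setI_iff]
  refine and_congr_right fun hp => ?_
  rw [torusChar_affineMap, linearPhase_eq hr hs (mem_setI_iff.1 hp), h.zsmul_freq, ← add_smul]
  have hcoef : -(((l : ℤ) * r * s * (((r : ℤ) - s) / 2) + k) * a) * r +
      -(((l : ℤ) * r * s * (((r : ℤ) - s) / 2) + k) * b) * s +
      l * r * s * (((r : ℤ) - s) / 2) + k = 0 := by
    linear_combination -((l : ℤ) * r * s * (((r : ℤ) - s) / 2) + k) * hab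
  rw [hcoef, zero_smul, add_zero]

/-! ### Characters constant along an orbit -/

/-- If the phase `M α + n freq` vanishes modulo `1`, then `n freq` is in `ℤ α + ℤ`. -/
theorem inIntSpan_of_phase_eq_zero {α t : ℝ} {M n : ℤ}
    (h : M • (α : UnitAddCircle) + n • (t : UnitAddCircle) = 0) : InIntSpan α (n * t) := by
  rw [← AddCircle.coe_zsmul, ← AddCircle.coe_zsmul, ← AddCircle.coe_add,
    AddCircle.coe_eq_zero_iff] at h
  obtain ⟨m, hm⟩ := h
  simp only [zsmul_eq_mul, mul_one] at hm
  refine ⟨-M, m, ?_⟩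
  push_cast
  linarith

theorem InRatSpan.of_inIntSpan {α t : ℝ} {n : ℤ} (hn : n ≠ 0) (h : InIntSpan α (n * t)) :
    InRatSpan α t := by
  obtain ⟨p, q, hpq⟩ := h
  have hn' : (n : ℝ) ≠ 0 := by exact_mod_cast hn
  refine ⟨p / n, q / n, ?_⟩
  push_cast
  field_simp
  linarith

theorem InRatSpan.exists_inIntSpan {α t : ℝ} (h : InRatSpan α t) :
    ∃ n : ℕ, 0 < n ∧ InIntSpan α (n * t) := by
  obtain ⟨p, q, rfl⟩ := h
  refine ⟨p.den * q.den, Nat.mul_pos p.pos q.pos, p.num * q.den, q.num * p.den, ?_⟩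
  have hp : (p : ℝ) * p.den = p.num := by exact_mod_cast Rat.mul_den_eq_num p
  have hq : (q : ℝ) * q.den = q.num := by exact_mod_cast Rat.mul_den_eq_num q
  push_cast
  rw [← hp, ← hq]
  ring

theorem exists_isResonance {α γ : ℝ} {r s : ℕ} {c₁ : ℝ} (h : InRatSpan α (freq γ r s c₁)) :
    ∃ l k, IsResonance α γ r s c₁ l k := by
  have hex : ∃ n : ℕ, 0 < n ∧ InIntSpan α (n * r * s * freq γ r s c₁) := by
    obtain ⟨n, hn, p, q, hpq⟩ := h.exists_inIntSpan
    refine ⟨n, hn, p * (r * s), q * (r * s), ?_⟩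
    push_cast
    linear_combination (r : ℝ) * s * hpq
  classical
  have hl := Nat.find_spec hex
  obtain ⟨-, k, m, hkm⟩ := id hl
  exact ⟨Nat.find hex, k, ⟨hl, fun n hn => Nat.find_min' hex hn⟩, m, by rw [hkm]; ring⟩

theorem IsResonance.unique {α γ : ℝ} (hα : Irrational α) {r s : ℕ} {c₁ : ℝ} {l l' : ℕ} {k k' : ℤ}
    (h : IsResonance α γ r s c₁ l k) (h' : IsResonance α γ r s c₁ l' k') : l = l' ∧ k = k' := by
  obtain rfl := h.1.unique h'.1
  refine ⟨rfl, sub_eq_zero.1 (eq_zero_of_zsmul_coe_eq_zero hα ?_)⟩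
  rw [sub_smul, ← h.zsmul_freq, ← h'.zsmul_freq, sub_self]

theorem IsResonance.dvd {α γ : ℝ} {r s : ℕ} {c₁ : ℝ} {l : ℕ} {k : ℤ}
    (h : IsResonance α γ r s c₁ l k) {q : ℤ}
    (hq : InIntSpan α ((q * r * s : ℤ) * freq γ r s c₁)) : (l : ℤ) ∣ q := by
  obtain ⟨⟨⟨hl, p, m, hpm⟩, hmin⟩, -⟩ := h
  obtain ⟨p', m', hpm'⟩ := hq
  have hl' : (0 : ℤ) < l := by exact_mod_cast hl
  refine Int.dvd_of_emod_eq_zero ?_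
  by_contra hne
  have hpos : 0 < q % l := lt_of_le_of_ne (Int.emod_nonneg q hl'.ne') (Ne.symm hne)
  obtain ⟨n, hn⟩ := Int.eq_ofNat_of_zero_le hpos.le
  have hqn : (q : ℝ) = l * (q / l : ℤ) + n := by
    have := Int.mul_ediv_add_emod q l
    rw [hn] at this
    exact_mod_cast this.symm
  have hmem : 0 < n ∧ InIntSpan α (n * r * s * freq γ r s c₁) := by
    refine ⟨by omega, p' - (q / l : ℤ) * p, m' - (q / l : ℤ) * m, ?_⟩
    push_cast at hpm' ⊢
    rw [hqn] at hpm'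
    linear_combination hpm' - ((q / l : ℤ) : ℝ) * hpm
  have hle : l ≤ n := hmin hmem
  have hlt := Int.emod_lt_of_pos q hl'
  omega

/-- On the subgroup `s x = r y`, which is parametrized by `t = a x + b y` through `x = r t` and
`y = s t`, the character `m₁ x + m₂ y` of the base equals `(m₁ r + m₂ s) t`. -/
theorem torusChar_base {r s : ℕ} {a b : ℤ} (hab : a * r + b * s = 1) (m₁ m₂ j k : ℤ)
    {h : Torus4} (hh : torusChar s (-r) 0 0 h = 0) :
    torusChar m₁ m₂ j k h = torusChar ((m₁ * r + m₂ * s) * a) ((m₁ * r + m₂ * s) * b) j k h := by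
  simp only [torusChar_apply] at hh ⊢
  have h₁ : (a * r + b * s) • h.1.1 = h.1.1 := by rw [hab, one_smul]
  have h₂ : (a * r + b * s) • h.1.2 = h.1.2 := by rw [hab, one_smul]
  linear_combination (norm := module) -(m₁ • h₁) - m₂ • h₂ + (m₁ * b - m₂ * a) • hh

/-- Without resonance a character with constant phase on an orbit is trivial on the subgroup
`s x = r y`. -/
theorem torusChar_eq_zero_of_not_inRatSpan {α γ : ℝ} (hα : Irrational α) {r s : ℕ} (hr : Odd r)
    (hs : Odd s) (hrs : Nat.Coprime r s) {a b : ℤ} (hab : a * r + b * s = 1) {c₁ : ℝ}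
    (hc : ¬ InRatSpan α (freq γ r s c₁)) {p : Torus4} (hp : p ∈ setI r s c₁) {m₁ m₂ j k : ℤ}
    (hA : linearPhase α γ r s m₁ m₂ j k p = 0)
    (hB : (j * r ^ 2 + k * s ^ 2) • (α : UnitAddCircle) = 0) {h : Torus4}
    (hh : torusChar s (-r) 0 0 h = 0) : torusChar m₁ m₂ j k h = 0 := by
  obtain ⟨q, rfl, rfl⟩ := exists_eq_mul_sq hs.pos.ne' hrs (eq_zero_of_zsmul_coe_eq_zero hα hB)
  rw [linearPhase_eq hr hs (mem_setI_iff.1 hp)] at hA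
  have hq : q = 0 := by
    by_contra hq
    have hqrs : q * r * s ≠ 0 :=
      mul_ne_zero (mul_ne_zero hq (by exact_mod_cast hr.pos.ne')) (by exact_mod_cast hs.pos.ne')
    exact hc (InRatSpan.of_inIntSpan hqrs (inIntSpan_of_phase_eq_zero hA))
  subst hq
  simp only [zero_mul, zero_smul, add_zero] at hA
  rw [torusChar_base hab _ _ _ _ hh, eq_zero_of_zsmul_coe_eq_zero hα hA]
  simp [torusChar_apply]

/-- At a resonance a character with constant phase on an orbit is, on the subgroup `s x = r y`, a
multiple of the character that defines the sets `setJ`. -/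
theorem torusChar_eq_zero_of_isResonance {α γ : ℝ} (hα : Irrational α) {r s : ℕ} (hr : Odd r)
    (hs : Odd s) (hrs : Nat.Coprime r s) {a b : ℤ} (hab : a * r + b * s = 1) {c₁ : ℝ} {l : ℕ}
    {k₀ : ℤ} (hres : IsResonance α γ r s c₁ l k₀) {p : Torus4} (hp : p ∈ setI r s c₁)
    {m₁ m₂ j k : ℤ} (hA : linearPhase α γ r s m₁ m₂ j k p = 0)
    (hB : (j * r ^ 2 + k * s ^ 2) • (α : UnitAddCircle) = 0) {h : Torus4}
    (hh : torusChar s (-r) 0 0 h = 0)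
    (hh' : torusChar (-(((l : ℤ) * r * s * (((r : ℤ) - s) / 2) + k₀) * a))
      (-(((l : ℤ) * r * s * (((r : ℤ) - s) / 2) + k₀) * b)) (l * s ^ 2) (-(l * r ^ 2)) h = 0) :
    torusChar m₁ m₂ j k h = 0 := by
  obtain ⟨q, rfl, rfl⟩ := exists_eq_mul_sq hs.pos.ne' hrs (eq_zero_of_zsmul_coe_eq_zero hα hB)
  rw [linearPhase_eq hr hs (mem_setI_iff.1 hp)] at hA
  obtain ⟨q, rfl⟩ := hres.dvd (inIntSpan_of_phase_eq_zero hA)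
  have hA' : (m₁ * r + m₂ * s + l * q * r * s * (((r : ℤ) - s) / 2) + q * k₀) •
      (α : UnitAddCircle) = 0 := by
    rw [← hA, show (l : ℤ) * q * r * s = q * (l * r * s) by ring, mul_smul q _ (_ : UnitAddCircle),
      hres.zsmul_freq]
    module
  have hM := eq_zero_of_zsmul_coe_eq_zero hα hA'
  have hM' : m₁ * r + m₂ * s = -q * ((l : ℤ) * r * s * (((r : ℤ) - s) / 2) + k₀) := by
    linear_combination hM
  rw [torusChar_base hab _ _ _ _ hh, hM']
  rw [torusChar_apply] at hh' ⊢
  linear_combination (norm := module) q • hh'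

/-! ### The partition into components -/

theorem empty_notMem_components (α γ : ℝ) (r s : ℕ) (a b : ℤ) : ∅ ∉ components α γ r s a b := by
  rintro (⟨c₁, -, -, h⟩ | ⟨c₁, -, c₂, -, -, l, k, -, h⟩)
  · have hmem : ((0, (c₁ : UnitAddCircle)), (0, 0)) ∈ setI r s c₁ :=
      mem_setI_iff.2 (by simp [torusChar_apply])
    rwa [← h] at hmem
  · have hmem : ((0, (c₁ : UnitAddCircle)), (0, (c₂ : UnitAddCircle))) ∈ setJ r s a b l k c₁ c₂ :=
      ⟨0, 0, 0, 0, by simp, by simp, by simp⟩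
    rwa [← h] at hmem

theorem exists_coe_mem_Ico {n : ℕ} (hn : 0 < n) (x : UnitAddCircle) :
    ∃ c ∈ Ico (0 : ℝ) (1 / n), (n : ℤ) • (c : UnitAddCircle) = x := by
  obtain ⟨d, hd, rfl⟩ := AddCircle.eq_coe_Ico x
  have hn' : (0 : ℝ) < n := by exact_mod_cast hn
  refine ⟨d / n, ⟨div_nonneg hd.1 hn'.le, by gcongr; exact hd.2⟩, ?_⟩
  rw [← AddCircle.coe_zsmul, zsmul_eq_mul, Int.cast_natCast, mul_div_cancel₀ _ hn'.ne']

theorem eq_of_mem_Ico_of_zsmul_eq {n : ℕ} (hn : 0 < n) {c c' : ℝ} (hc : c ∈ Ico (0 : ℝ) (1 / n))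
    (hc' : c' ∈ Ico (0 : ℝ) (1 / n))
    (h : (n : ℤ) • (c : UnitAddCircle) = (n : ℤ) • (c' : UnitAddCircle)) : c = c' := by
  have hn' : (0 : ℝ) < n := by exact_mod_cast hn
  have hmem : ∀ t ∈ Ico (0 : ℝ) (1 / n), (n : ℤ) • t ∈ Ico (0 : ℝ) (0 + 1) := fun t ht => by
    rw [zsmul_eq_mul, Int.cast_natCast, zero_add]
    exact ⟨mul_nonneg hn'.le ht.1, by have := ht.2; rwa [lt_div_iff₀' hn'] at this⟩
  rw [← AddCircle.coe_zsmul, ← AddCircle.coe_zsmul,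
    AddCircle.coe_eq_coe_iff_of_mem_Ico (hmem c hc) (hmem c' hc')] at h
  simpa [hn.ne'] using h

theorem exists_mem_components {α γ : ℝ} {r s : ℕ} (hr : 0 < r) (a b : ℤ) (p : Torus4) :
    ∃ C ∈ components α γ r s a b, p ∈ C := by
  obtain ⟨c₁, hc₁, hrc⟩ := exists_coe_mem_Ico hr (-torusChar s (-r) 0 0 p)
  have hp : torusChar s (-r) 0 0 p = -((r : ℤ) • (c₁ : UnitAddCircle)) := by rw [hrc, neg_neg]
  by_cases hc : InRatSpan α (freq γ r s c₁)
  swap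
  · exact ⟨_, Or.inl ⟨c₁, hc₁, hc, rfl⟩, mem_setI_iff.2 hp⟩
  obtain ⟨l, k, hres⟩ := exists_isResonance hc
  have hl : 0 < l := hres.1.1.1
  set K : ℤ := (l : ℤ) * r * s * (((r : ℤ) - s) / 2) + k with hK
  obtain ⟨c₂, hc₂, hlc⟩ := exists_coe_mem_Ico (n := l * r ^ 2) (by positivity)
    (-(torusChar (-(K * a)) (-(K * b)) (l * s ^ 2) (-(l * r ^ 2)) p) -
      (K * b) • (c₁ : UnitAddCircle))
  -- `c₂` is found in `[0, 1 / (l r²))`, a subset of `[0, 1 / r²)`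
  refine ⟨_, Or.inr ⟨c₁, hc₁, c₂, ⟨hc₂.1, hc₂.2.trans_le ?_⟩, hc, l, k, hres, rfl⟩,
    mem_setJ_iff.2 ⟨hp, ?_⟩⟩
  · have hr' : (0 : ℝ) < r := by exact_mod_cast hr
    have hl' : (1 : ℝ) ≤ l := by exact_mod_cast hl
    push_cast
    exact one_div_le_one_div_of_le (by positivity) (le_mul_of_one_le_left (by positivity) hl')
  · push_cast at hlc
    rw [hlc]
    abel

theorem eq_of_mem_components {α γ : ℝ} (hα : Irrational α) {r s : ℕ} (hr : 0 < r) {a b : ℤ}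
    {C D : Set Torus4} (hC : C ∈ components α γ r s a b) (hD : D ∈ components α γ r s a b)
    {p : Torus4} (hpC : p ∈ C) (hpD : p ∈ D) : C = D := by
  have hc : ∀ {c₁ d₁ : ℝ}, c₁ ∈ Ico (0 : ℝ) (1 / r) → d₁ ∈ Ico (0 : ℝ) (1 / r) →
      p ∈ setI r s c₁ → p ∈ setI r s d₁ → c₁ = d₁ := fun hc hd h h' =>
    eq_of_mem_Ico_of_zsmul_eq hr hc hd
      (neg_injective ((mem_setI_iff.1 h).symm.trans (mem_setI_iff.1 h')))
  rcases hC with ⟨c₁, hc₁, hfc, rfl⟩ | ⟨c₁, hc₁, c₂, -, hfc, l, k, hres, rfl⟩ <;>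
  rcases hD with ⟨d₁, hd₁, hfd, rfl⟩ | ⟨d₁, hd₁, d₂, -, hfd, l', k', hres', rfl⟩
  · rw [hc hc₁ hd₁ hpC hpD]
  · obtain rfl := hc hc₁ hd₁ hpC (setJ_subset_setI hpD)
    exact absurd hfd hfc
  · obtain rfl := hc hc₁ hd₁ (setJ_subset_setI hpC) hpD
    exact absurd hfc hfd
  -- different values of `c₂` may define the same set, but not sets with a common point
  · obtain rfl := hc hc₁ hd₁ (setJ_subset_setI hpC) (setJ_subset_setI hpD)
    obtain ⟨rfl, rfl⟩ := hres.unique hα hres'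
    ext x
    rw [mem_setJ_iff, mem_setJ_iff, ← (mem_setJ_iff.1 hpC).2, ← (mem_setJ_iff.1 hpD).2]

theorem isPartition_components {α γ : ℝ} (hα : Irrational α) {r s : ℕ} (hr : 0 < r) (a b : ℤ) :
    Setoid.IsPartition (components α γ r s a b) := by
  refine ⟨empty_notMem_components α γ r s a b, fun p => ?_⟩
  obtain ⟨C, hC, hp⟩ := exists_mem_components hr a b p
  exact ⟨C, ⟨hC, hp⟩, fun D ⟨hD, hpD⟩ => eq_of_mem_components hα hr hD hC hpD hp⟩

/-- The cosets that make up the family satisfy the hypotheses of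
`exists_isGenericPartition_of_cosets`. -/
theorem exists_isGenericPartition {α γ : ℝ} (hα : Irrational α) {r s : ℕ} (hr : Odd r)
    (hs : Odd s) (hrs : Nat.Coprime r s) {a b : ℤ} (hab : a * r + b * s = 1) :
    ∃ ν, IsGenericPartition (affineMap α γ r s) (components α γ r s a b) ν := by
  refine exists_isGenericPartition_of_cosets (continuous_affineMap α γ r s)
    (isPartition_components hα hr.pos a b) ?_ ?_ torusCharGroup ?_ torusCharGroup_separates ?_
  · rintro C (⟨c₁, -, -, rfl⟩ | ⟨c₁, -, c₂, -, -, l, k, -, rfl⟩)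
    · simp only [Set.ext fun p => mem_setI_iff (p := p)]
      exact isClosed_eq (continuous_torusChar _ _ _ _) continuous_const
    · rw [Set.ext fun p => mem_setJ_iff (p := p)]
      exact (isClosed_eq (continuous_torusChar _ _ _ _) continuous_const).inter
        (isClosed_eq (continuous_torusChar _ _ _ _) continuous_const)
  · rintro C (⟨c₁, -, -, rfl⟩ | ⟨c₁, -, c₂, -, -, l, k, hres, rfl⟩)
    · exact Set.ext fun p => affineMap_mem_setI_iff
    · exact Set.ext fun p => affineMap_mem_setJ_iff hr hs hab hres
  · rintro _ ⟨m₁, m₂, j, k, rfl⟩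
    exact continuous_torusChar _ _ _ _
  have hB : ∀ c : ℤ, c • (α : UnitAddCircle) ≠ 0 → ∀ n : ℤ, n ≠ 0 →
      n • c • (α : UnitAddCircle) ≠ 0 := fun c hc n hn h => by
    rw [← mul_smul] at h
    rcases mul_eq_zero.1 (eq_zero_of_zsmul_coe_eq_zero hα h) with h' | h'
    · exact hn h'
    · exact hc (by rw [h', zero_smul])
  rintro C (⟨c₁, -, hc, rfl⟩ | ⟨c₁, -, c₂, -, -, l, k₀, hres, rfl⟩)
  · refine ⟨(torusChar s (-r) 0 0).ker, fun x hx y => ?_, ?_⟩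
    · rw [mem_setI_iff, AddMonoidHom.mem_ker, map_sub, mem_setI_iff.1 hx, sub_eq_zero]
    rintro x hx _ ⟨m₁, m₂, j, k, rfl⟩
    exact ⟨_, _, hB _, torusChar_iterate α γ r s m₁ m₂ j k x, fun hA hB h hh =>
      torusChar_eq_zero_of_not_inRatSpan hα hr hs hrs hab hc hx hA hB hh⟩
  · refine ⟨(torusChar s (-r) 0 0).ker ⊓
      (torusChar (-(((l : ℤ) * r * s * (((r : ℤ) - s) / 2) + k₀) * a))
        (-(((l : ℤ) * r * s * (((r : ℤ) - s) / 2) + k₀) * b)) (l * s ^ 2) (-(l * r ^ 2))).ker,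
      fun x hx y => ?_, ?_⟩
    · rw [mem_setJ_iff, AddSubgroup.mem_inf, AddMonoidHom.mem_ker, AddMonoidHom.mem_ker, map_sub,
        map_sub, (mem_setJ_iff.1 hx).1, (mem_setJ_iff.1 hx).2, sub_eq_zero, sub_eq_zero]
    rintro x hx _ ⟨m₁, m₂, j, k, rfl⟩
    exact ⟨_, _, hB _, torusChar_iterate α γ r s m₁ m₂ j k x, fun hA hB h hh =>
      torusChar_eq_zero_of_isResonance hα hr hs hrs hab hres (setJ_subset_setI hx) hA hB hh.1 hh.2⟩

end AffineCocycle

theorem mainTheorem6 (α γ : ℝ) (hα : Irrational α) (r s : ℕ) (hr : 3 ≤ r) (hs : 3 ≤ s)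
    (hr_odd : Odd r) (hs_odd : Odd s) (hrs : Nat.Coprime r s)
    (a b : ℤ) (hab : a * r + b * s = 1) :
    Setoid.IsPartition (AffineCocycle.components α γ r s a b) ∧
    {M | AffineCocycle.IsMinimalComponent (AffineCocycle.affineMap α γ r s) M} =
      AffineCocycle.components α γ r s a b ∧
    AffineCocycle.ergodicComponents (AffineCocycle.affineMap α γ r s) =
      AffineCocycle.components α γ r s a b ∧
    (∀ μ : MeasureTheory.Measure AffineCocycle.Torus4, MeasureTheory.IsProbabilityMeasure μ →
      MeasureTheory.MeasurePreserving (AffineCocycle.affineMap α γ r s) μ μ →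
      AffineCocycle.IsErgodicPartition (AffineCocycle.affineMap α γ r s) μ
        (AffineCocycle.components α γ r s a b)) ∧
    (∀ C ∈ AffineCocycle.components α γ r s a b,
      AffineCocycle.IsUniquelyErgodicOn (AffineCocycle.affineMap α γ r s) C) ∧
    (∀ C ∈ AffineCocycle.components α γ r s a b,
      ∀ ν : MeasureTheory.Measure AffineCocycle.Torus4, MeasureTheory.IsProbabilityMeasure ν →
      MeasureTheory.MeasurePreserving (AffineCocycle.affineMap α γ r s) ν ν → ν Cᶜ = 0 →
      ∀ x ∈ C, AffineCocycle.IsGeneric (AffineCocycle.affineMap α γ r s) ν x) := by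
  obtain ⟨ν, hν⟩ := AffineCocycle.exists_isGenericPartition (γ := γ) hα hr_odd hs_odd hrs hab
  have hΦ := AffineCocycle.continuous_affineMap α γ r s
  refine ⟨hν.isPartition, hν.setOf_isMinimalComponent, hν.ergodicComponents_eq hΦ,
    fun μ _ hμ => hν.isErgodicPartition hΦ hμ, fun C hC => hν.isUniquelyErgodicOn hΦ hC,
    fun C hC μ _ hμ h0 x hx => ?_⟩
  rw [hν.eq_measure hΦ hC hμ h0]
  exact hν.generic C hC x hx
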